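/- Let $n\ge 2$, let $\mathcal G$ be a connected weighted undirected graph on $\{1,\dots,n\}$ with symmetric nonnegative weights $a_{ij}$, $a_{ii}=0$, and Laplacian $L=\mathrm{Deg}-A$; let $\rho=\rho(L)$ be its spectral radius and $\rho_2=\rho_2(L)$ its smallest positive eigenvalue. Let $f_1,\dots,f_n:\mathbb R^p\to\mathbb R$ be differentiable with $L_f$-Lipschitz gradients ($L_f>0$), let $f=\frac1n\sum_i f_i$ have a nonempty set $\mathbb X^*$ of global minimizers, with minimum value $f^*$, and suppose that for some $\nu>0$ one has $\frac12\|\nabla f(x)\|^2\ge\nu(f(x)-f^*)$ for all $x\in\mathbb R^p$ (the Polyak–Łojasiewicz condition). For $\delta>0$ put $\hat\nabla f_i(x,\delta)=\frac1\delta\sum_{l=1}^p(f_i(x+\delta e_l)-f_i(x))e_l$. From arbitrary $x_{i,0}\in\mathbb R^p$ and $v_{i,0}=0$, let the sequences be generated for $k\ge 0$ by $$x_{i,k+1}=x_{i,k}-\eta\Big(\alpha\sum_{j}L_{ij}x_{j,k}+\beta v_{i,k}+\hat\nabla f_i(x_{i,k},\delta_{i,k})\Big),\qquad v_{i,k+1}=v_{i,k}+\eta\beta\sum_jL_{ij}x_{j,k}.$$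 Define $$\tilde\kappa_1=\tfrac{2+9L_f^2}{2\rho_2},\quad \kappa_2>1,\quad \kappa_3=\tfrac14\Big(1+\sqrt{1+8\kappa_2+\tfrac8{\rho_2}}\Big),$$ $$\tilde\kappa_4=6\big(\kappa_2+\tfrac1{\rho_2}\big)L_f^2+2\sqrt{9\big(\kappa_2+\tfrac1{\rho_2}\big)^2L_f^4+3L_f^2},$$ $$\tilde\epsilon_1=(\alpha-\beta)\rho_2-\tfrac12(2+9L_f^2),\quad \tilde\epsilon_2=\beta^2\rho+(2\alpha^2+\beta^2)\rho^2+\tfrac{15}2L_f^2,$$ $$\epsilon_3=\beta-\tfrac12-\tfrac{\alpha}{2\beta^2}-\tfrac1{2\beta\rho_2},\quad \epsilon_4=2\beta^2+\tfrac12,$$ $$\tilde\epsilon_5=\tfrac18-\tfrac3{2\beta}\big(\tfrac1\beta+\tfrac1{\rho_2}+\tfrac\alpha\beta\big)L_f^2,\quad \tilde\epsilon_6=\tfrac3{\beta^2}\big(1+\tfrac1{\rho_2}+\tfrac\alpha\beta\big)L_f^2+\tfrac{L_f(1+3L_f)}2,$$ $$\epsilon_8=\tfrac{\alpha+\beta}{2\beta}+\tfrac1{2\rho_2},\quad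 \epsilon_9=\min\big\{\tfrac1{2\rho},\tfrac{\alpha-\beta}{2\alpha}\big\},\quad \tilde\epsilon_{10}=\eta\min\{\tilde\epsilon_1-\eta\tilde\epsilon_2,\ \epsilon_3-\eta\epsilon_4,\ \tfrac\nu4\},\quad \tilde\epsilon=\tfrac{\tilde\epsilon_{10}}{\epsilon_8},$$ $$\epsilon_{12}=\Big(\big(\tfrac1{\beta^2}+\tfrac1{2\eta\beta}\big)\big(\tfrac1{\rho_2}+\tfrac\alpha\beta\big)+\tfrac1{2\eta\beta^2}+\tfrac1{\beta^2}+\tfrac12\Big)\tfrac{3npL_f^2}4,\quad \epsilon_{11}=\big(\tfrac{15\eta}4+5\eta^2\big)\tfrac{3npL_f^2}4+\epsilon_{12}.$$ Suppose that $$\alpha\in(\beta+\tilde\kappa_1,\kappa_2\beta],\quad \beta>\max\{\tfrac{\tilde\kappa_1}{\kappa_2-1},\kappa_3,\tilde\kappa_4\},\quad \eta\in\big(0,\min\{\tfrac{\tilde\epsilon_1}{\tilde\epsilon_2},\tfrac{\epsilon_3}{\epsilon_4},\tfrac{\tilde\epsilon_5}{\tilde\epsilon_6}\}\big),$$ that $\hat\epsilon\in(0,1)$,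 $\breve\epsilon\in(\hat\epsilon,1)$, and that $\delta_{i,k}\in(0,\hat\epsilon^{k/2}]$ for all $i,k$. Write $\bar x_k=\frac1n\sum_ix_{i,k}$, $\boldsymbol x_k=\mathrm{col}(x_{1,k},\dots,x_{n,k})$, $\boldsymbol v_k=\mathrm{col}(v_{1,k},\dots,v_{n,k})$, $\bar{\boldsymbol x}_k=\mathbf 1_n\otimes\bar x_k$, $\boldsymbol K=(I_n-\frac1n\mathbf 1_n\mathbf 1_n^\top)\otimes I_p$, $\|z\|_{\boldsymbol K}^2=z^\top\boldsymbol Kz$, $\delta_0=\max_i\delta_{i,0}$, $\boldsymbol h_0^0=\mathrm{col}(\hat\nabla f_1(\bar x_0,\delta_0),\dots,\hat\nabla f_n(\bar x_0,\delta_0))$, $\hat U_0=\|\boldsymbol x_0\|^2_{\boldsymbol K}+\|\boldsymbol v_0+\frac1\beta\boldsymbol h^0_0\|^2_{\boldsymbol K}+n(f(\bar x_0)-f^*)$, and $$\phi_k=\Big(\frac{\epsilon_{11}}{1-\tilde\epsilon}+\epsilon_{12}\Big)\cdot\begin{cases}\dfrac{(1-\tilde\epsilon)^{k+1}}{1-\tilde\epsilon-\hat\epsilon},&1-\tilde\epsilon>\hat\epsilon,\\[2mm]\dfrac{\hat\epsilon^{k+1}}{\hat\epsilon+\tilde\epsilon-1},&1-\tilde\epsilon<\hat\epsilon,\\[2mm]\dfrac{\breve\epsilon^{k+1}}{\breve\epsilon-\hat\epsilon},&1-\tilde\epsilon=\hat\epsilon.\end{cases}$$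 Then $0<\tilde\epsilon<1$, and for all integers $k\ge 0$ $$\|\boldsymbol x_k-\bar{\boldsymbol x}_k\|^2+n(f(\bar x_k)-f^*)\le\frac1{\epsilon_9}\big((1-\tilde\epsilon)^{k+1}\epsilon_8\hat U_0+\phi_k\big).$$ Moreover, if the projection $\mathcal P_{\mathbb X^*}$ (sending each $x\in\mathbb R^p$ to a nearest point of $\mathbb X^*$) is well defined, then for all integers $k\ge 0$ $$\|\boldsymbol x_k-\mathbf 1_n\otimes\mathcal P_{\mathbb X^*}(\bar x_k)\|^2\le\frac1{\epsilon_9}\Big(1+\frac1{2\nu}\Big)\big((1-\tilde\epsilon)^{k+1}\epsilon_8\hat U_0+\phi_k\big).$$ -/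

import Mathlib

noncomputable section

namespace ZeroOrderPD

/-! ### Weighted undirected graphs -/

/-- A weighted undirected graph on the vertex set `Fin n`, given by its weighted adjacency matrix:
symmetric, nonnegative, with zero diagonal. -/
structure WGraph (n : ℕ) where
  /-- the weighted adjacency matrix -/
  A : Matrix (Fin n) (Fin n) ℝ
  symm : ∀ i j, A i j = A j i
  nonneg : ∀ i j, 0 ≤ A i j
  diag_zero : ∀ i, A i i = 0

namespace WGraph

variable {n : ℕ}

/-- The underlying simple graph: `i` and `j` are linked iff `0 < a i j`. -/
def toSimpleGraph (G : WGraph n) : SimpleGraph (Fin n) where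
  Adj i j := 0 < G.A i j
  symm := ⟨fun i j h => by rw [G.symm j i]; exact h⟩
  loopless := ⟨fun i h => by rw [G.diag_zero i] at h; exact lt_irrefl _ h⟩

/-- The graph is connected: any two vertices are joined by a path of links of positive weight. -/
def Connected (G : WGraph n) : Prop := G.toSimpleGraph.Connected

/-- The weighted degree of a vertex. -/
def deg (G : WGraph n) (i : Fin n) : ℝ := ∑ j, G.A i j

/-- The Laplacian matrix `L = Deg - A`. -/
def lap (G : WGraph n) : Matrix (Fin n) (Fin n) ℝ := Matrix.diagonal G.deg - G.A

/-- The spectral radius `ρ(L)` of the Laplacian (a real symmetric matrix, so that all its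
eigenvalues are real). -/
def rho (G : WGraph n) : ℝ := (spectralRadius ℝ G.lap).toReal

/-- `ρ₂(L)`: the minimum positive eigenvalue of the Laplacian. -/
def rho2 (G : WGraph n) : ℝ := sInf {μ : ℝ | μ ∈ spectrum ℝ G.lap ∧ 0 < μ}

end WGraph

/-! ### Cost functions -/

/-- The decision space `ℝ^p` with its Euclidean norm. -/
abbrev Vec (p : ℕ) : Type := EuclideanSpace ℝ (Fin p)

/-- `f` is smooth with constant `Lf`: differentiable with `Lf`-Lipschitz gradient. -/
def IsSmooth {p : ℕ} (f : Vec p → ℝ) (Lf : ℝ) : Prop :=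
  Differentiable ℝ f ∧ ∀ x y, ‖gradient f x - gradient f y‖ ≤ Lf * ‖x - y‖

/-- The global cost `f = (1/n) ∑ f_i`. -/
def globalCost {n p : ℕ} (f : Fin n → Vec p → ℝ) (x : Vec p) : ℝ :=
  (1 / (n : ℝ)) * ∑ i, f i x

/-- The set of global minimizers. -/
def optSet {p : ℕ} (f : Vec p → ℝ) : Set (Vec p) := {x | ∀ y, f x ≤ f y}

/-- The optimal value `f*`; it is the minimum of `f` as soon as `optSet f` is nonempty. -/
def optVal {p : ℕ} (f : Vec p → ℝ) : ℝ := ⨅ x, f x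

/-- The Polyak–Łojasiewicz condition with constant `ν`. -/
def SatisfiesPL {p : ℕ} (f : Vec p → ℝ) (ν : ℝ) : Prop :=
  ∀ x, (1 / 2) * ‖gradient f x‖ ^ 2 ≥ ν * (f x - optVal f)

/-- `P` is a projection operator onto `S`: `P x` is a point of `S` nearest to `x`. -/
def IsProjection {p : ℕ} (S : Set (Vec p)) (P : Vec p → Vec p) : Prop :=
  ∀ x, P x ∈ S ∧ ∀ y ∈ S, ‖x - P x‖ ^ 2 ≤ ‖x - y‖ ^ 2

/-- The deterministic gradient estimator `(1/δ) ∑ₗ (f(x + δ eₗ) - f(x)) eₗ`. -/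
def gradEst {p : ℕ} (f : Vec p → ℝ) (x : Vec p) (δ : ℝ) : Vec p :=
  (1 / δ) • ∑ l : Fin p,
    (f (x + δ • EuclideanSpace.single l (1 : ℝ)) - f x) • EuclideanSpace.single l (1 : ℝ)

/-! ### The algorithm -/

/-- `x, v` (indexed by time, then by agent) are generated by the distributed deterministic
zeroth-order primal–dual algorithm, started from an arbitrary `x 0` and from `v 0 = 0`. -/
structure IsRun {n p : ℕ} (G : WGraph n) (f : Fin n → Vec p → ℝ) (α β η : ℝ)
    (δ : Fin n → ℕ → ℝ) (x v : ℕ → Fin n → Vec p) : Prop where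
  init : ∀ i, v 0 i = 0
  x_step : ∀ k i, x (k + 1) i =
    x k i - η • (α • ∑ j, G.lap i j • x k j + β • v k i + gradEst (f i) (x k i) (δ i k))
  v_step : ∀ k i, v (k + 1) i = v k i + (η * β) • ∑ j, G.lap i j • x k j

/-- The average of the agents' vectors. -/
def avg {n p : ℕ} (z : Fin n → Vec p) : Vec p := (1 / (n : ℝ)) • ∑ i, z i

/-- The squared Euclidean norm in `ℝ^(np)` of the stacked vector `col(z_1, …, z_n)`. -/
def stackSq {n p : ℕ} (z : Fin n → Vec p) : ℝ := ∑ i, ‖z i‖ ^ 2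

/-- The matrix `K_n = I_n - (1/n) 1 1ᵀ`. -/
def Kmat (n : ℕ) : Matrix (Fin n) (Fin n) ℝ := 1 - (1 / (n : ℝ)) • Matrix.of fun _ _ => 1

/-- The quadratic form `‖z‖²_{M ⊗ I_p} = zᵀ (M ⊗ I_p) z` of the stacked vector. -/
def stackQuad {n p : ℕ} (M : Matrix (Fin n) (Fin n) ℝ) (z : Fin n → Vec p) : ℝ :=
  ∑ i, ∑ j, M i j * inner ℝ (z i) (z j)

/-- `δ_k = max_i δ_{i,k}`. -/
def deltaMax {n : ℕ} (δ : Fin n → ℕ → ℝ) (k : ℕ) : ℝ := ⨆ i, δ i k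

/-- `Û_k = ‖x_k‖²_K + ‖v_k + (1/β) h⁰_k‖²_K + n (f(x̄_k) - f*)`, where `h⁰_k` stacks the
estimators of the `f_i` at the average `x̄_k` with exploration parameter `δ_k`. -/
def Uhat {n p : ℕ} (f : Fin n → Vec p → ℝ) (β : ℝ) (δ : Fin n → ℕ → ℝ)
    (x v : ℕ → Fin n → Vec p) (k : ℕ) : ℝ :=
  stackQuad (Kmat n) (x k)
    + stackQuad (Kmat n)
        (fun i => v k i + (1 / β) • gradEst (f i) (avg (x k)) (deltaMax δ k))
    + n * (globalCost f (avg (x k)) - optVal (globalCost f))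

/-! ### The constants

Here `ρ = ρ(L)`, `ρ₂ = ρ₂(L)`; a trailing `t` stands for a tilde. -/

def kappa1t (ρ₂ Lf : ℝ) : ℝ := 1 / (2 * ρ₂) * (2 + 9 * Lf ^ 2)

def kappa3 (ρ₂ κ₂ : ℝ) : ℝ := 1 / 4 * (1 + √(1 + 8 * κ₂ + 8 / ρ₂))

def kappa4t (ρ₂ Lf κ₂ : ℝ) : ℝ :=
  6 * (κ₂ + 1 / ρ₂) * Lf ^ 2 + 2 * √(9 * (κ₂ + 1 / ρ₂) ^ 2 * Lf ^ 4 + 3 * Lf ^ 2)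

def eps1t (ρ₂ Lf α β : ℝ) : ℝ := (α - β) * ρ₂ - 1 / 2 * (2 + 9 * Lf ^ 2)

def eps2t (ρ Lf α β : ℝ) : ℝ :=
  β ^ 2 * ρ + (2 * α ^ 2 + β ^ 2) * ρ ^ 2 + 15 / 2 * Lf ^ 2

def eps3 (ρ₂ α β : ℝ) : ℝ := β - 1 / 2 - α / (2 * β ^ 2) - 1 / (2 * β * ρ₂)

def eps4 (β : ℝ) : ℝ := 2 * β ^ 2 + 1 / 2

def eps5t (ρ₂ Lf α β : ℝ) : ℝ :=
  1 / 8 - 3 / (2 * β) * (1 / β + 1 / ρ₂ + α / β) * Lf ^ 2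

def eps6t (ρ₂ Lf α β : ℝ) : ℝ :=
  3 / β ^ 2 * (1 + 1 / ρ₂ + α / β) * Lf ^ 2 + Lf * (1 + 3 * Lf) / 2

def eps8 (ρ₂ α β : ℝ) : ℝ := (α + β) / (2 * β) + 1 / (2 * ρ₂)

def eps9 (ρ α β : ℝ) : ℝ := min (1 / (2 * ρ)) ((α - β) / (2 * α))

def eps10t (ρ ρ₂ Lf ν α β η : ℝ) : ℝ :=
  η * min (eps1t ρ₂ Lf α β - η * eps2t ρ Lf α β) (min (eps3 ρ₂ α β - η * eps4 β) (ν / 4))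

/-- The rate constant `ε̃ = ε̃₁₀ / ε₈`. -/
def epst (ρ ρ₂ Lf ν α β η : ℝ) : ℝ := eps10t ρ ρ₂ Lf ν α β η / eps8 ρ₂ α β

def eps12 (n p : ℕ) (ρ₂ Lf α β η : ℝ) : ℝ :=
  ((1 / β ^ 2 + 1 / (2 * η * β)) * (1 / ρ₂ + α / β)
      + 1 / (2 * η * β ^ 2) + 1 / β ^ 2 + 1 / 2) * (3 * n * p * Lf ^ 2 / 4)

def eps11 (n p : ℕ) (ρ₂ Lf α β η : ℝ) : ℝ :=
  (15 * η / 4 + 5 * η ^ 2) * (3 * n * p * Lf ^ 2 / 4) + eps12 n p ρ₂ Lf α β η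

/-- `φ(ε̃, ε̂, ε̆)` at time `k`; the arguments `e11`, `e12` are the constants `ε₁₁`, `ε₁₂`. -/
def phi (e11 e12 εt εh εb : ℝ) (k : ℕ) : ℝ :=
  (e11 / (1 - εt) + e12) *
    (if 1 - εt > εh then (1 - εt) ^ (k + 1) / (1 - εt - εh)
     else if 1 - εt < εh then εh ^ (k + 1) / (εh + εt - 1)
     else εb ^ (k + 1) / (εb - εh))

end ZeroOrderPD

end

open ZeroOrderPD

/-!
The proof is a Lyapunov argument. Write `y` for the disagreement of the agents (the projection of
the stacked primal variable onto the stacks whose blocks sum to zero), `u` for the projection of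
the dual variable shifted by `1 / β` times the estimators at the average, and `F` for the gap
`n (f(x̄) - f*)`. With `Q` the pseudoinverse of the Laplacian, the function

  `V = ½‖y‖² + ½⟨u, (Q + α / β) u⟩ + ⟨y, u⟩ + m F`

contracts by the factor `1 - ε̃` in each step, up to terms of order `δ²` (`IsRun.lyap_succ_le`).
The quadratic part is handled by an exact expansion in an abstract inner product space, in which the
weight `Q + α / β` makes the mixed terms of first order cancel; the remaining ones are split by
Young's inequality (`lyapQuad_step_le`). The cost part follows from the descent lemma and the
Polyak–Łojasiewicz condition (`IsRun.costGap_succ_le`), and `lyap_combine` adds the two. The spectral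
facts about `Q` and the Laplacian come from the continuous functional calculus and are transported
to stacked vectors by `matAct`. Solving the scalar recursion (`le_of_geometric_recursion`,
`mul_geom_sum_le`) gives `V k ≤ (1 - ε̃) ^ k * V 0 + φ k`.

Two points need care. The bound carries the exponent `k + 1` rather than `k`: the additional factor
`1 - ε̃` is paid for by the slack in `V 0 ≤ ε₈ Û₀`, since `ε₈` is the trace of a `2 × 2` matrix of
which only the largest eigenvalue is needed (`lyap_zero_le`). Secondly, the Polyak–Łojasiewicz
condition gives quadratic growth with `‖x - P x‖² ≤ (2 / ν) (f x - f*)`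
(`SatisfiesPL.norm_sub_projection_sq_le`), and `2 / ν` may exceed `1 + 1 / (2 ν)`. The bound on the
distance to the minimizers still holds because the weight `m = max 1 (4 ε₉)` of the cost may replace
`1` without harming the decrease of `V` or the estimate of its initial value (`costWeight_le`).
-/

noncomputable section

namespace ZeroOrderPD

open Filter Topology

/-! ### Smooth functions -/

section Smooth

variable {p : ℕ} {f : Vec p → ℝ} {L : ℝ}

/-- The quadratic Taylor estimate for a function with Lipschitz gradient. -/
lemma IsSmooth.abs_taylor_le (hf : IsSmooth f L) (x h : Vec p) :
    |f (x + h) - f x - inner ℝ (gradient f x) h| ≤ L / 2 * ‖h‖ ^ 2 := by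
  have hline : ∀ t : ℝ, HasDerivAt (fun t : ℝ => x + t • h) h t := fun t => by
    simpa using ((hasDerivAt_id t).smul_const h).const_add x
  have hder : ∀ t : ℝ, HasDerivAt
      (fun t : ℝ => f (x + t • h) - f x - t * inner ℝ (gradient f x) h)
      (inner ℝ (gradient f (x + t • h)) h - inner ℝ (gradient f x) h) t := fun t => by
    have h1 := (hf.1 (x + t • h)).hasFDerivAt.comp_hasDerivAt t (hline t)
    rw [← inner_gradient_left] at h1
    refine (h1.sub_const (f x)).sub ?_
    simpa only [one_mul, id] using (hasDerivAt_id t).mul_const (inner ℝ (gradient f x) h)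
  have hB : ∀ t : ℝ, HasDerivAt (fun t : ℝ => L / 2 * ‖h‖ ^ 2 * t ^ 2) (L * ‖h‖ ^ 2 * t) t :=
    fun t => by
      have h1 := (hasDerivAt_pow 2 t).const_mul (L / 2 * ‖h‖ ^ 2)
      refine h1.congr_deriv ?_
      push_cast
      ring
  have key := image_norm_le_of_norm_deriv_right_le_deriv_boundary (a := 0) (b := 1)
    (fun t _ => (hder t).continuousAt.continuousWithinAt)
    (fun t _ => (hder t).hasDerivWithinAt) (B := fun t : ℝ => L / 2 * ‖h‖ ^ 2 * t ^ 2)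
    (by simp) hB (fun t ht => by
      rw [← inner_sub_left]
      refine (norm_inner_le_norm _ _).trans ?_
      have h1 := hf.2 (x + t • h) x
      rw [add_sub_cancel_left, norm_smul, Real.norm_of_nonneg ht.1] at h1
      calc _ ≤ L * (t * ‖h‖) * ‖h‖ := mul_le_mul_of_nonneg_right h1 (norm_nonneg _)
        _ = _ := by ring) (x := 1) (by simp)
  simpa using key

/-- The error of the gradient estimator: each of its `p` coordinates is within `L δ / 2` of the
corresponding partial derivative. -/
lemma IsSmooth.norm_gradEst_sub_sq_le (hf : IsSmooth f L) (x : Vec p) {δ : ℝ} (hδ : 0 < δ) :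
    ‖gradEst f x δ - gradient f x‖ ^ 2 ≤ p * L ^ 2 * δ ^ 2 / 4 := by
  have hc : ∀ l : Fin p, ((gradEst f x δ - gradient f x) l) ^ 2 ≤ L ^ 2 * δ ^ 2 / 4 := by
    intro l
    have h1 := hf.abs_taylor_le x (δ • EuclideanSpace.single l (1 : ℝ))
    have h2 : (gradEst f x δ) l =
        1 / δ * (f (x + δ • EuclideanSpace.single l (1 : ℝ)) - f x) := by
      simp [gradEst, Finset.sum_apply, Pi.single_apply]
    rw [PiLp.sub_apply, h2]
    rw [inner_smul_right, EuclideanSpace.inner_single_right, norm_smul] at h1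
    simp only [PiLp.norm_single, norm_one, mul_one, one_mul, conj_trivial,
      Real.norm_of_nonneg hδ.le] at h1
    set A := f (x + δ • EuclideanSpace.single l (1 : ℝ)) - f x
    set g := gradient f x l
    have h3 : 1 / δ * A - g = (A - δ * g) / δ := by field_simp
    have h4 : (A - δ * g) ^ 2 ≤ (L / 2 * δ ^ 2) ^ 2 := sq_le_sq' (abs_le.1 h1).1 (abs_le.1 h1).2
    rw [h3, div_pow, div_le_iff₀ (by positivity)]
    calc _ ≤ _ := h4
      _ = _ := by ring
  rw [EuclideanSpace.real_norm_sq_eq]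
  calc _ ≤ ∑ _l : Fin p, L ^ 2 * δ ^ 2 / 4 := Finset.sum_le_sum fun l _ => hc l
    _ = _ := by simp; ring

end Smooth

/-! ### The average of smooth functions -/

section GlobalCost

variable {n p : ℕ} {f : Fin n → Vec p → ℝ} {L : ℝ}

lemma gradient_globalCost (hf : ∀ i, IsSmooth (f i) L) (x : Vec p) :
    gradient (globalCost f) x = avg fun i => gradient (f i) x := by
  refine HasGradientAt.gradient ?_
  rw [hasGradientAt_iff_hasFDerivAt]
  have h1 : HasFDerivAt (fun x => ∑ i, f i x) (∑ i, fderiv ℝ (f i) x) x :=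
    HasFDerivAt.fun_sum fun i _ => ((hf i).1 x).hasFDerivAt
  refine (h1.const_mul (1 / (n : ℝ))).congr_fderiv ?_
  simp [avg, toDual_gradient]

lemma differentiable_globalCost (hf : ∀ i, IsSmooth (f i) L) : Differentiable ℝ (globalCost f) := by
  unfold globalCost
  exact (Differentiable.fun_sum fun i _ => (hf i).1).const_mul _

lemma isSmooth_globalCost (hn : 0 < n) (hf : ∀ i, IsSmooth (f i) L) :
    IsSmooth (globalCost f) L := by
  refine ⟨differentiable_globalCost hf, fun x y => ?_⟩
  have hn' : (0 : ℝ) < n := Nat.cast_pos.2 hn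
  rw [gradient_globalCost hf, gradient_globalCost hf, avg, avg, ← smul_sub,
    ← Finset.sum_sub_distrib, norm_smul, Real.norm_of_nonneg (by positivity)]
  calc _ ≤ 1 / (n : ℝ) * ∑ _i : Fin n, L * ‖x - y‖ := by
        gcongr
        exact (norm_sum_le _ _).trans (Finset.sum_le_sum fun i _ => (hf i).2 x y)
    _ = _ := by simp; field_simp

end GlobalCost

lemma optVal_le {p : ℕ} {f : Vec p → ℝ} (h : (optSet f).Nonempty) (x : Vec p) :
    optVal f ≤ f x := by
  obtain ⟨z, hz⟩ := h
  exact ciInf_le ⟨f z, by rintro _ ⟨y, rfl⟩; exact hz y⟩ x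

/-! ### Quadratic growth under the Polyak–Łojasiewicz condition -/

section QuadraticGrowth

variable {p : ℕ} {f : Vec p → ℝ} {L ν : ℝ}

lemma IsSmooth.continuous_gradient (hf : IsSmooth f L) : Continuous (gradient f) := by
  have hL : LipschitzWith L.toNNReal (gradient f) := LipschitzWith.of_dist_le_mul fun x y => by
    rw [dist_eq_norm, dist_eq_norm]
    exact (hf.2 x y).trans (mul_le_mul_of_nonneg_right (Real.le_coe_toNNReal L) (norm_nonneg _))
  exact hL.continuous

/-- A gradient step of size `s` is at most a constant times the decrease of `√(f - f*)`. -/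
lemma gradient_step_le (hf : IsSmooth f L) (hopt : (optSet f).Nonempty) (hν : 0 < ν)
    (hPL : SatisfiesPL f ν) {s : ℝ} (hs : 0 < s) (hsL : 0 < 1 - L * s / 2) (y : Vec p) :
    ‖y - (y - s • gradient f y)‖ ≤ 2 / ((1 - L * s / 2) * √(2 * ν)) *
      (√(f y - optVal f) - √(f (y - s • gradient f y) - optVal f)) := by
  have h1 := (abs_le.1 (hf.abs_taylor_le y (-(s • gradient f y)))).2
  rw [← sub_eq_add_neg, norm_neg, norm_smul, Real.norm_of_nonneg hs.le, inner_neg_right,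
    inner_smul_right, real_inner_self_eq_norm_sq] at h1
  rw [sub_sub_cancel, norm_smul, Real.norm_of_nonneg hs.le]
  have h2 := hPL y
  have hF := sub_nonneg.2 (optVal_le hopt y)
  have hF' := sub_nonneg.2 (optVal_le hopt (y - s • gradient f y))
  set g := ‖gradient f y‖
  have hg : 0 ≤ g := norm_nonneg _
  set F := f y - optVal f with hFdef
  set F' := f (y - s • gradient f y) - optVal f with hFdef'
  set σ := 1 - L * s / 2 with hσ
  have hdec : s * σ * g ^ 2 ≤ F - F' := by
    rw [hFdef, hFdef', hσ]; nlinarith [h1]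
  have hle : F' ≤ F := by
    have : 0 ≤ s * σ * g ^ 2 := by positivity
    linarith
  have hr : √F' ≤ √F := Real.sqrt_le_sqrt hle
  have hq : 0 < √(2 * ν) := Real.sqrt_pos.2 (by positivity)
  rw [div_mul_eq_mul_div, le_div_iff₀ (by positivity)]
  rcases hg.eq_or_lt with h0 | h0
  · rw [← h0]; nlinarith
  · have hrg : √(2 * ν) * √F ≤ g := by
      rw [← Real.sqrt_mul (by positivity)]
      exact Real.sqrt_le_iff.2 ⟨hg, by linarith⟩
    have hfac : F - F' = (√F - √F') * (√F + √F') := by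
      nlinarith [Real.sq_sqrt hF, Real.sq_sqrt hF']
    have h3 : (√F - √F') * (√F + √F') ≤ (√F - √F') * (2 * √F) :=
      mul_le_mul_of_nonneg_left (by linarith) (by linarith)
    have h4 : (√F - √F') * (√(2 * ν) * √F) ≤ (√F - √F') * g :=
      mul_le_mul_of_nonneg_left hrg (by linarith)
    have h5 : √(2 * ν) * (s * σ * g ^ 2) ≤ √(2 * ν) * ((√F - √F') * (2 * √F)) :=
      mul_le_mul_of_nonneg_left (by linarith) hq.le
    refine le_of_mul_le_mul_right ?_ h0
    nlinarith

/-- Gradient descent from `x` with a small step `s` converges to a global minimizer whose distance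
from `x` is controlled by `√(f x - f*)`. -/
lemma exists_mem_optSet_norm_sub_le (hf : IsSmooth f L) (hopt : (optSet f).Nonempty) (hν : 0 < ν)
    (hPL : SatisfiesPL f ν) {s : ℝ} (hs : 0 < s) (hsL : 0 < 1 - L * s / 2) (x : Vec p) :
    ∃ z ∈ optSet f, ‖x - z‖ ≤ 2 / ((1 - L * s / 2) * √(2 * ν)) * √(f x - optVal f) := by
  set C := 2 / ((1 - L * s / 2) * √(2 * ν)) with hCdef
  have hC : 0 ≤ C := by positivity
  set T : Vec p → Vec p := fun y => y - s • gradient f y with hT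
  set r : Vec p → ℝ := fun y => √(f y - optVal f) with hrdef
  have hstep : ∀ y, ‖y - T y‖ ≤ C * (r y - r (T y)) := fun y =>
    gradient_step_le hf hopt hν hPL hs hsL y
  have hdist : ∀ j, dist (T^[j] x) (T^[j + 1] x) ≤ C * (r (T^[j] x) - r (T^[j + 1] x)) := by
    intro j
    rw [Function.iterate_succ_apply', dist_eq_norm]
    exact hstep _
  have hsum : Summable fun j => C * (r (T^[j] x) - r (T^[j + 1] x)) := by
    refine summable_of_sum_range_le (c := C * r x) (fun j => dist_nonneg.trans (hdist j))
      fun m => ?_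
    rw [← Finset.mul_sum, Finset.sum_range_sub']
    exact mul_le_mul_of_nonneg_left (sub_le_self _ (Real.sqrt_nonneg _)) hC
  obtain ⟨z, hz⟩ := cauchySeq_tendsto_of_complete (cauchySeq_of_dist_le_of_summable _ hdist hsum)
  have hTc : Continuous T := continuous_id.sub (hf.continuous_gradient.const_smul s)
  have hfix : T z = z := isFixedPt_of_tendsto_iterate hz hTc.continuousAt
  have hg : gradient f z = 0 := by
    have h1 : s • gradient f z = 0 := by simpa [hT] using hfix
    exact (smul_eq_zero.1 h1).resolve_left hs.ne'
  refine ⟨z, fun y => ?_, ?_⟩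
  · have h1 := hPL z
    rw [hg, norm_zero] at h1
    have h2 := optVal_le hopt y
    nlinarith
  · have hbound : ∀ j, ‖x - T^[j] x‖ ≤ C * r x := by
      intro j
      rw [← dist_eq_norm]
      refine (dist_le_range_sum_of_dist_le (f := fun j => T^[j] x) j fun _ => hdist _).trans ?_
      rw [← Finset.mul_sum, Finset.sum_range_sub']
      exact mul_le_mul_of_nonneg_left (sub_le_self _ (Real.sqrt_nonneg _)) hC
    exact le_of_tendsto ((tendsto_const_nhds.sub hz).norm) (Eventually.of_forall hbound)

/-- Quadratic growth with the sharp constant, obtained from gradient descent by letting the step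
size tend to zero. -/
lemma SatisfiesPL.norm_sub_projection_sq_le (hPL : SatisfiesPL f ν) (hf : IsSmooth f L)
    (hopt : (optSet f).Nonempty) (hν : 0 < ν) {P : Vec p → Vec p}
    (hP : IsProjection (optSet f) P) (x : Vec p) :
    ν * ‖x - P x‖ ^ 2 ≤ 2 * (f x - optVal f) := by
  have hF := sub_nonneg.2 (optVal_le hopt x)
  have hq : 0 < √(2 * ν) := Real.sqrt_pos.2 (by positivity)
  have hlim : Tendsto (fun s : ℝ => 1 - L * s / 2) (𝓝[>] 0) (𝓝 1) := by
    have : Continuous fun s : ℝ => 1 - L * s / 2 := by fun_prop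
    simpa using (this.tendsto 0).mono_left nhdsWithin_le_nhds
  have key : √(2 * ν) * ‖x - P x‖ ≤ 2 * √(f x - optVal f) := by
    have h1 : Tendsto (fun s : ℝ => (1 - L * s / 2) * (√(2 * ν) * ‖x - P x‖)) (𝓝[>] 0)
        (𝓝 (1 * (√(2 * ν) * ‖x - P x‖))) := hlim.mul_const _
    rw [one_mul] at h1
    refine le_of_tendsto h1 ?_
    filter_upwards [self_mem_nhdsWithin, hlim.eventually_const_lt (zero_lt_one)] with s hs hsL
    obtain ⟨z, hz, hxz⟩ := exists_mem_optSet_norm_sub_le hf hopt hν hPL hs hsL x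
    have h2 : ‖x - P x‖ ≤ ‖x - z‖ := (sq_le_sq₀ (norm_nonneg _) (norm_nonneg _)).1 ((hP x).2 z hz)
    have h3 := h2.trans hxz
    rw [div_mul_eq_mul_div, le_div_iff₀ (by positivity)] at h3
    linarith
  have h4 : (√(2 * ν) * ‖x - P x‖) ^ 2 ≤ (2 * √(f x - optVal f)) ^ 2 :=
    pow_le_pow_left₀ (by positivity) key 2
  rw [mul_pow, mul_pow, Real.sq_sqrt (by positivity), Real.sq_sqrt hF] at h4
  linarith

end QuadraticGrowth

/-! ### Spectral theory of the Laplacian -/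

namespace WGraph

variable {n : ℕ} (G : WGraph n)

lemma lap_apply (i j : Fin n) : G.lap i j = (if i = j then G.deg i else 0) - G.A i j := by
  simp [lap, Matrix.diagonal_apply]

lemma lap_symm (i j : Fin n) : G.lap i j = G.lap j i := by
  rw [lap_apply, lap_apply, G.symm i j]
  by_cases h : i = j
  · simp [h]
  · simp [h, Ne.symm h]

lemma lap_isHermitian : G.lap.IsHermitian := by
  ext i j
  simp [G.lap_symm j i]

lemma sum_lap_row (i : Fin n) : ∑ j, G.lap i j = 0 := by
  simp [lap_apply, deg]

lemma lap_mulVec_apply (x : Fin n → ℝ) (i : Fin n) :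
    G.lap.mulVec x i = ∑ j, G.A i j * (x i - x j) := by
  simp only [Matrix.mulVec, dotProduct, lap_apply, sub_mul, ite_mul, zero_mul, mul_sub,
    Finset.sum_sub_distrib, Finset.sum_ite_eq, Finset.mem_univ, if_true, ← Finset.sum_mul]
  rfl

/-- The Laplacian quadratic form as a sum over the links. -/
lemma two_mul_dotProduct_lap_mulVec (x : Fin n → ℝ) :
    2 * dotProduct x (G.lap.mulVec x) = ∑ i, ∑ j, G.A i j * (x i - x j) ^ 2 := by
  have h1 : dotProduct x (G.lap.mulVec x) = ∑ i, ∑ j, G.A i j * (x i * (x i - x j)) := by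
    simp only [dotProduct, lap_mulVec_apply, Finset.mul_sum]
    exact Finset.sum_congr rfl fun i _ => Finset.sum_congr rfl fun j _ => by ring
  have h2 : dotProduct x (G.lap.mulVec x) = ∑ i, ∑ j, G.A i j * (x j * (x j - x i)) := by
    rw [h1, Finset.sum_comm]
    exact Finset.sum_congr rfl fun i _ => Finset.sum_congr rfl fun j _ => by rw [G.symm]
  rw [two_mul]
  nth_rewrite 1 [h1]
  rw [h2, ← Finset.sum_add_distrib]
  refine Finset.sum_congr rfl fun i _ => ?_
  rw [← Finset.sum_add_distrib]
  exact Finset.sum_congr rfl fun j _ => by ring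

lemma posSemidef_lap : G.lap.PosSemidef := by
  refine Matrix.PosSemidef.of_dotProduct_mulVec_nonneg G.lap_isHermitian fun x => ?_
  have h := G.two_mul_dotProduct_lap_mulVec x
  have h2 : 0 ≤ ∑ i, ∑ j, G.A i j * (x i - x j) ^ 2 := Finset.sum_nonneg fun i _ =>
    Finset.sum_nonneg fun j _ => mul_nonneg (G.nonneg i j) (sq_nonneg _)
  simp only [star_trivial]
  linarith

/-- On a connected graph the kernel of the Laplacian consists of the constant vectors. -/
lemma Connected.eq_of_lap_mulVec_eq_zero {G : WGraph n} (hG : G.Connected) {x : Fin n → ℝ}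
    (hx : G.lap.mulVec x = 0) (i j : Fin n) : x i = x j := by
  have h := G.two_mul_dotProduct_lap_mulVec x
  rw [hx, dotProduct_zero, mul_zero] at h
  have hadj : ∀ i j, G.toSimpleGraph.Adj i j → x i = x j := by
    intro i j hij
    have h1 := (Finset.sum_eq_zero_iff_of_nonneg fun i _ => Finset.sum_nonneg fun j _ =>
      mul_nonneg (G.nonneg i j) (sq_nonneg (x i - x j))).1 h.symm i (Finset.mem_univ i)
    have h2 := (Finset.sum_eq_zero_iff_of_nonneg fun j _ =>
      mul_nonneg (G.nonneg i j) (sq_nonneg (x i - x j))).1 h1 j (Finset.mem_univ j)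
    have hA : 0 < G.A i j := hij
    have h3 := (mul_eq_zero.1 h2).resolve_left hA.ne'
    exact sub_eq_zero.1 (pow_eq_zero_iff (two_ne_zero)|>.1 h3)
  obtain ⟨w⟩ := SimpleGraph.Connected.preconnected hG i j
  induction w with
  | nil => rfl
  | cons h' _ ih => exact (hadj _ _ h').trans ih

lemma finite_spectrum : (spectrum ℝ G.lap).Finite := Matrix.finite_spectrum _

lemma spectrum_nonneg {μ : ℝ} (hμ : μ ∈ spectrum ℝ G.lap) : 0 ≤ μ := by
  have h := hμ
  rw [G.lap_isHermitian.spectrum_real_eq_range_eigenvalues] at h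
  obtain ⟨i, rfl⟩ := h
  exact G.posSemidef_lap.eigenvalues_nonneg i

lemma le_rho {μ : ℝ} (hμ : μ ∈ spectrum ℝ G.lap) : μ ≤ G.rho := by
  have htop : spectralRadius ℝ G.lap ≠ ⊤ := by
    obtain ⟨C, hC⟩ := (G.finite_spectrum.image fun k => ‖k‖₊).bddAbove
    refine ne_top_of_le_ne_top (ENNReal.coe_ne_top (r := C)) ?_
    exact iSup₂_le fun k hk => ENNReal.coe_le_coe.2 (hC ⟨k, hk, rfl⟩)
  have h1 : (‖μ‖₊ : ENNReal) ≤ spectralRadius ℝ G.lap :=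
    le_iSup₂ (f := fun k (_ : k ∈ spectrum ℝ G.lap) => (‖k‖₊ : ENNReal)) μ hμ
  have h2 := ENNReal.toReal_mono htop h1
  simp only [ENNReal.coe_toReal, coe_nnnorm] at h2
  exact (le_abs_self μ).trans h2

lemma rho2_le {μ : ℝ} (hμ : μ ∈ spectrum ℝ G.lap) (h0 : 0 < μ) : G.rho2 ≤ μ :=
  csInf_le ⟨0, fun _ h => h.2.le⟩ ⟨hμ, h0⟩

lemma continuousOn_spectrum (g : ℝ → ℝ) : ContinuousOn g (spectrum ℝ G.lap) :=
  G.finite_spectrum.continuousOn g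

lemma lap_isSelfAdjoint : IsSelfAdjoint G.lap := G.lap_isHermitian

/-- On a connected graph with at least two vertices the Laplacian has a positive eigenvalue. -/
lemma Connected.rho2_mem {G : WGraph n} (hG : G.Connected) (hn : 2 ≤ n) :
    G.rho2 ∈ spectrum ℝ G.lap ∧ 0 < G.rho2 := by
  have hfin : {μ : ℝ | μ ∈ spectrum ℝ G.lap ∧ 0 < μ}.Finite :=
    G.finite_spectrum.subset fun _ h => h.1
  refine Set.Nonempty.csInf_mem ?_ hfin
  by_contra hne
  have h0 : ∀ μ ∈ spectrum ℝ G.lap, μ = 0 := fun μ hμ =>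
    le_antisymm (not_lt.1 fun h => hne ⟨μ, hμ, h⟩) (G.spectrum_nonneg hμ)
  have hL : G.lap = 0 := by
    rw [← cfc_id ℝ G.lap G.lap_isSelfAdjoint, ← cfc_zero (R := ℝ) (a := G.lap)]
    exact cfc_congr fun μ hμ => h0 μ hμ
  have h1 := hG.eq_of_lap_mulVec_eq_zero (x := Pi.single ⟨0, by omega⟩ 1) (by rw [hL, Matrix.zero_mulVec])
    ⟨0, by omega⟩ ⟨1, by omega⟩
  simp at h1

lemma posSemidef_cfc {g : ℝ → ℝ} (hg : ∀ μ ∈ spectrum ℝ G.lap, 0 ≤ g μ) :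
    (cfc g G.lap).PosSemidef := by
  open scoped MatrixOrder in
  exact Matrix.nonneg_iff_posSemidef.1 (cfc_nonneg hg)

/-- The pseudoinverse of the Laplacian: the functional calculus of `μ ↦ μ⁻¹`, where `0⁻¹ = 0`. -/
def pinv : Matrix (Fin n) (Fin n) ℝ := cfc (fun μ : ℝ => μ⁻¹) G.lap

lemma pinv_mul_lap : G.pinv * G.lap = cfc (fun μ : ℝ => μ⁻¹ * μ) G.lap := by
  rw [cfc_mul _ _ _ (G.continuousOn_spectrum _) (G.continuousOn_spectrum _),
    cfc_id' ℝ G.lap G.lap_isSelfAdjoint]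
  rfl

lemma lap_mul_pinv_mul_lap : G.lap * (G.pinv * G.lap) = G.lap := by
  rw [pinv_mul_lap]
  nth_rewrite 1 [← cfc_id' ℝ G.lap G.lap_isSelfAdjoint]
  rw [← cfc_mul _ _ _ (G.continuousOn_spectrum _) (G.continuousOn_spectrum _)]
  nth_rewrite 2 [← cfc_id' ℝ G.lap G.lap_isSelfAdjoint]
  refine cfc_congr fun μ _ => ?_
  by_cases h : μ = 0
  · simp [h]
  · simp [h]

lemma posSemidef_pinv : G.pinv.PosSemidef :=
  G.posSemidef_cfc fun _ hμ => inv_nonneg.2 (G.spectrum_nonneg hμ)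

lemma cfc_const_sub (r : ℝ) (g : ℝ → ℝ) :
    cfc (fun μ => r - g μ) G.lap = r • (1 : Matrix (Fin n) (Fin n) ℝ) - cfc g G.lap := by
  rw [cfc_sub _ _ _ (G.continuousOn_spectrum _) (G.continuousOn_spectrum _),
    cfc_const r G.lap G.lap_isSelfAdjoint, Algebra.algebraMap_eq_smul_one]

lemma posSemidef_inv_rho2_sub_pinv (h0 : 0 < G.rho2) :
    (G.rho2⁻¹ • (1 : Matrix (Fin n) (Fin n) ℝ) - G.pinv).PosSemidef := by
  rw [pinv, ← G.cfc_const_sub]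
  refine G.posSemidef_cfc fun μ hμ => sub_nonneg.2 ?_
  rcases (G.spectrum_nonneg hμ).eq_or_lt with h | h
  · rw [← h]; simpa using h0.le
  · exact inv_anti₀ h0 (G.rho2_le hμ h)

lemma posSemidef_rho_sub_lap : (G.rho • (1 : Matrix (Fin n) (Fin n) ℝ) - G.lap).PosSemidef := by
  have h := G.cfc_const_sub G.rho fun μ => μ
  rw [cfc_id' ℝ G.lap G.lap_isSelfAdjoint] at h
  rw [← h]
  exact G.posSemidef_cfc fun μ hμ => sub_nonneg.2 (G.le_rho hμ)

lemma posSemidef_rho_sq_sub_lap_mul_lap :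
    (G.rho ^ 2 • (1 : Matrix (Fin n) (Fin n) ℝ) - G.lap * G.lap).PosSemidef := by
  have h : G.lap * G.lap = cfc (fun μ : ℝ => μ * μ) G.lap := by
    rw [cfc_mul _ _ _ (G.continuousOn_spectrum _) (G.continuousOn_spectrum _),
      cfc_id' ℝ G.lap G.lap_isSelfAdjoint]
  rw [h, ← G.cfc_const_sub]
  refine G.posSemidef_cfc fun μ hμ => sub_nonneg.2 ?_
  have := G.spectrum_nonneg hμ
  have := G.le_rho hμ
  nlinarith

lemma posSemidef_lap_sub_rho2 : (G.lap - G.rho2 • (G.pinv * G.lap)).PosSemidef := by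
  rw [pinv_mul_lap, ← cfc_const_mul _ _ _ (G.continuousOn_spectrum _)]
  nth_rewrite 1 [← cfc_id' ℝ G.lap G.lap_isSelfAdjoint]
  rw [← cfc_sub _ _ _ (G.continuousOn_spectrum _) (G.continuousOn_spectrum _)]
  refine G.posSemidef_cfc fun μ hμ => sub_nonneg.2 ?_
  rcases (G.spectrum_nonneg hμ).eq_or_lt with h | h
  · rw [← h]; simp
  · rw [inv_mul_cancel₀ h.ne', mul_one]; exact G.rho2_le hμ h

lemma pinv_mul_lap_isHermitian : (G.pinv * G.lap).IsHermitian := by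
  rw [pinv_mul_lap]
  exact (G.posSemidef_cfc (g := fun μ : ℝ => μ⁻¹ * μ) fun μ hμ =>
    mul_nonneg (inv_nonneg.2 (G.spectrum_nonneg hμ)) (G.spectrum_nonneg hμ)).1

/-- On a connected graph `L⁺ L` is the identity up to a matrix with constant entries, hence it
fixes every vector whose entries sum to zero. -/
lemma Connected.one_sub_pinv_mul_lap {G : WGraph n} (hG : G.Connected) :
    ∃ c : ℝ, ∀ i j, (1 - G.pinv * G.lap) i j = c := by
  set N : Matrix (Fin n) (Fin n) ℝ := 1 - G.pinv * G.lap with hN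
  have hLN : G.lap * N = 0 := by rw [hN, mul_sub, mul_one, lap_mul_pinv_mul_lap, sub_self]
  have hcol : ∀ i i' j, N i j = N i' j := by
    intro i i' j
    refine hG.eq_of_lap_mulVec_eq_zero (x := fun i => N i j) ?_ i i'
    funext k
    exact congrFun (congrFun hLN k) j
  have hsymm : ∀ i j, N i j = N j i := fun i j => by
    have h : N.IsHermitian := Matrix.isHermitian_one.sub G.pinv_mul_lap_isHermitian
    simpa using (h.apply j i)
  rcases Nat.eq_zero_or_pos n with h0 | h0
  · exact ⟨0, fun i => absurd i.2 (by omega)⟩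
  · exact ⟨N ⟨0, h0⟩ ⟨0, h0⟩, fun i j => by rw [hcol i ⟨0, h0⟩ j, hsymm, hcol j ⟨0, h0⟩]⟩

end WGraph

/-! ### Matrices acting on stacked vectors -/

/-- The space of stacked vectors `col(z_1, …, z_n)`, that is `ℝ^(np)` with its Euclidean norm. -/
abbrev Stack (n p : ℕ) : Type := PiLp 2 fun _ : Fin n => Vec p

section MatAct

variable {n p : ℕ}

/-- The action of the matrix `M ⊗ I_p` on stacked vectors. -/
def matAct (M : Matrix (Fin n) (Fin n) ℝ) : Stack n p →ₗ[ℝ] Stack n p where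
  toFun z := WithLp.toLp 2 fun i => ∑ j, M i j • z j
  map_add' z w := by
    ext1 i
    simp [smul_add, Finset.sum_add_distrib]
  map_smul' c z := by
    ext1 i
    simp [Finset.smul_sum, smul_comm c]

@[simp] lemma matAct_apply (M : Matrix (Fin n) (Fin n) ℝ) (z : Stack n p) (i : Fin n) :
    matAct M z i = ∑ j, M i j • z j := rfl

lemma matAct_one (z : Stack n p) : matAct 1 z = z := by
  ext1 i
  simp [Matrix.one_apply, ite_smul]

lemma matAct_mul (M N : Matrix (Fin n) (Fin n) ℝ) (z : Stack n p) :
    matAct (M * N) z = matAct M (matAct N z) := by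
  ext1 i
  simp only [matAct_apply, Matrix.mul_apply, Finset.sum_smul, Finset.smul_sum, mul_smul]
  exact Finset.sum_comm

lemma matAct_sub (M N : Matrix (Fin n) (Fin n) ℝ) (z : Stack n p) :
    matAct (M - N) z = matAct M z - matAct N z := by
  ext1 i
  simp [sub_smul, Finset.sum_sub_distrib]

lemma matAct_smul (c : ℝ) (M : Matrix (Fin n) (Fin n) ℝ) (z : Stack n p) :
    matAct (c • M) z = c • matAct M z := by
  ext1 i
  simp [mul_smul, Finset.smul_sum]

lemma inner_matAct (M : Matrix (Fin n) (Fin n) ℝ) (z w : Stack n p) :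
    inner ℝ z (matAct M w) = ∑ i, ∑ j, M i j * inner ℝ (z i) (w j) := by
  simp [PiLp.inner_apply, inner_sum, inner_smul_right]

lemma inner_matAct_comm {M : Matrix (Fin n) (Fin n) ℝ} (hM : M.IsHermitian) (z w : Stack n p) :
    inner ℝ (matAct M z) w = inner ℝ z (matAct M w) := by
  rw [real_inner_comm, inner_matAct, inner_matAct, Finset.sum_comm]
  refine Finset.sum_congr rfl fun i _ => Finset.sum_congr rfl fun j _ => ?_
  rw [real_inner_comm]
  congr 1
  simpa using hM.apply i j

/-- A positive semidefinite matrix stays so after tensoring with `I_p`: apply it to each of the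
`p` coordinates separately. -/
lemma inner_matAct_nonneg {M : Matrix (Fin n) (Fin n) ℝ} (hM : M.PosSemidef) (z : Stack n p) :
    0 ≤ inner ℝ z (matAct M z) := by
  have h : inner ℝ z (matAct M z)
      = ∑ l : Fin p, dotProduct (fun i => z i l) (M.mulVec fun i => z i l) := by
    rw [inner_matAct]
    simp only [PiLp.inner_apply, dotProduct, Matrix.mulVec, Finset.mul_sum]
    conv_rhs => rw [Finset.sum_comm]
    refine Finset.sum_congr rfl fun i _ => ?_
    rw [Finset.sum_comm]
    refine Finset.sum_congr rfl fun l _ => Finset.sum_congr rfl fun j _ => ?_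
    simp
    ring
  rw [h]
  exact Finset.sum_nonneg fun l _ => by
    simpa using hM.dotProduct_mulVec_nonneg fun i => z i l

end MatAct

/-! ### The quadratic part of the Lyapunov function -/

section LyapQuad

variable {H : Type*} [NormedAddCommGroup H] [InnerProductSpace ℝ H]

/-- The quadratic form `½‖y‖² + ½⟨u, (Q + r) u⟩ + ⟨y, u⟩` in the disagreement `y` and the
centred shifted dual variable `u`; it is used with `Q` the pseudoinverse of the Laplacian and
`r = α / β`. -/
def lyapQuad (Q : H →ₗ[ℝ] H) (r : ℝ) (y u : H) : ℝ :=
  1 / 2 * ‖y‖ ^ 2 + 1 / 2 * (inner ℝ u (Q u) + r * ‖u‖ ^ 2) + inner ℝ y u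

lemma inner_le_weighted (a b : H) {s : ℝ} (hs : 0 < s) :
    inner ℝ a b ≤ s / 2 * ‖a‖ ^ 2 + 1 / (2 * s) * ‖b‖ ^ 2 := by
  have h := norm_sub_sq_real (s • a) b
  rw [norm_smul, Real.norm_of_nonneg hs.le, real_inner_smul_left] at h
  have h0 := sq_nonneg ‖s • a - b‖
  have h1 : s / 2 * ‖a‖ ^ 2 + 1 / (2 * s) * ‖b‖ ^ 2
      = 1 / (2 * s) * ((s * ‖a‖) ^ 2 + ‖b‖ ^ 2) := by field_simp
  rw [h1, one_div, inv_mul_eq_div, le_div_iff₀ (by positivity)]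
  linarith

/-- Weighted Young inequality for the semi-inner product of a positive symmetric operator. -/
lemma inner_apply_le_weighted {M : H →ₗ[ℝ] H} (hsymm : ∀ a b, inner ℝ (M a) b = inner ℝ a (M b))
    (hpos : ∀ a, 0 ≤ inner ℝ a (M a)) (a b : H) {s : ℝ} (hs : 0 < s) :
    inner ℝ a (M b) ≤ s / 2 * inner ℝ a (M a) + 1 / (2 * s) * inner ℝ b (M b) := by
  have h := hpos (s • a - b)
  have hba : inner ℝ b (M a) = inner ℝ a (M b) := by rw [real_inner_comm, hsymm]
  simp only [map_sub, map_smul, inner_sub_left, inner_sub_right, real_inner_smul_left,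
    real_inner_smul_right, hba] at h
  have h1 : s / 2 * inner ℝ a (M a) + 1 / (2 * s) * inner ℝ b (M b)
      = 1 / (2 * s) * (s * (s * inner ℝ a (M a)) + inner ℝ b (M b)) := by field_simp
  rw [h1, one_div, inv_mul_eq_div, le_div_iff₀ (by positivity)]
  linarith

/-- The change of the quadratic part in one step of a perturbed primal–dual iteration. The
perturbations are `e` in the primal and `d` in the dual update. -/
lemma lyapQuad_step_le {L Q : H →ₗ[ℝ] H} {ρ ρ₂ r β η : ℝ}
    (hQsymm : ∀ a b, inner ℝ (Q a) b = inner ℝ a (Q b))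
    (hQpos : ∀ a, 0 ≤ inner ℝ a (Q a)) (hQle : ∀ a, inner ℝ a (Q a) ≤ 1 / ρ₂ * ‖a‖ ^ 2)
    (hL1 : ∀ a, inner ℝ a (L a) ≤ ρ * ‖a‖ ^ 2) (hL2 : ∀ a, ‖L a‖ ^ 2 ≤ ρ ^ 2 * ‖a‖ ^ 2)
    (hr : 1 ≤ r) (hβ : 0 < β) (hη : 0 < η) {y : H} (hy : Q (L y) = y)
    (hyL : ρ₂ * ‖y‖ ^ 2 ≤ inner ℝ y (L y)) (u e d : H) :
    lyapQuad Q r (y - η • ((r * β) • L y + β • u + e)) (u + (η * β) • L y + d)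
      ≤ lyapQuad Q r y u
        - (η * ((r - 1) * β * ρ₂ - 1)
            - η ^ 2 * (β ^ 2 * ρ + (2 * (r * β) ^ 2 + β ^ 2) * ρ ^ 2)) * ‖y‖ ^ 2
        - (η * (β - 1 / 2 - (1 / ρ₂ + r) * (1 / β) / 2) - η ^ 2 * (2 * β ^ 2 + 1 / 2)) * ‖u‖ ^ 2
        + (η + 5 / 2 * η ^ 2) * ‖e‖ ^ 2
        + ((1 / ρ₂ + r) * (β * (1 / η) / 2 + 1) + 1 / η / 2 + 1 + β ^ 2 / 2) * ‖d‖ ^ 2 := by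
  have hQu : inner ℝ (L y) (Q u) = inner ℝ y u := by rw [← hQsymm, hy]
  have hQd : inner ℝ (L y) (Q d) = inner ℝ y d := by rw [← hQsymm, hy]
  have hdu : inner ℝ d (Q u) = inner ℝ u (Q d) := by rw [← hQsymm, real_inner_comm]
  have hM0 : 0 ≤ r := by linarith
  -- the exact expansion of the new value
  have hexp : lyapQuad Q r (y - η • ((r * β) • L y + β • u + e)) (u + (η * β) • L y + d)
      = lyapQuad Q r y u - η * (r - 1) * β * inner ℝ y (L y) - η * β * ‖u‖ ^ 2
        - η * inner ℝ y e - η * inner ℝ u e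
        + η ^ 2 / 2 * ‖(r * β) • L y + β • u + e‖ ^ 2
        + η ^ 2 * β ^ 2 / 2 * (inner ℝ y (L y) - r * ‖L y‖ ^ 2)
        - η ^ 2 * β ^ 2 * inner ℝ u (L y) - η ^ 2 * β * inner ℝ (L y) e
        + (inner ℝ u (Q d) + r * inner ℝ u d)
        + η * β * (inner ℝ y d + r * inner ℝ (L y) d)
        + 1 / 2 * (inner ℝ d (Q d) + r * ‖d‖ ^ 2)
        + inner ℝ y d
        - η * (r * β * inner ℝ (L y) d + β * inner ℝ u d + inner ℝ e d) := by
    simp only [lyapQuad, ← real_inner_self_eq_norm_sq, map_add, map_smul, inner_add_left,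
      inner_add_right, inner_sub_left, inner_sub_right, real_inner_smul_left,
      real_inner_smul_right, hy, hQu, hQd, hdu]
    simp only [real_inner_comm y (L y), real_inner_comm u (L y), real_inner_comm e (L y),
      real_inner_comm d (L y), real_inner_comm u y, real_inner_comm e y, real_inner_comm d y,
      real_inner_comm e u, real_inner_comm d u, real_inner_comm d e]
    ring
  -- three cross terms in the square
  have hsq : ‖(r * β) • L y + β • u + e‖ ^ 2
      ≤ 3 * ((r * β) ^ 2 * ‖L y‖ ^ 2 + β ^ 2 * ‖u‖ ^ 2 + ‖e‖ ^ 2) := by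
    have h1 := inner_le_weighted ((r * β) • L y) (β • u) one_pos
    have h2 := inner_le_weighted ((r * β) • L y) e one_pos
    have h3 := inner_le_weighted (β • u) e one_pos
    have h4 := norm_add_sq_real ((r * β) • L y + β • u) e
    have h5 := norm_add_sq_real ((r * β) • L y) (β • u)
    rw [inner_add_left] at h4
    have h6 : ‖(r * β) • L y‖ ^ 2 = (r * β) ^ 2 * ‖L y‖ ^ 2 := by
      rw [norm_smul, mul_pow, Real.norm_eq_abs, sq_abs]
    have h7 : ‖β • u‖ ^ 2 = β ^ 2 * ‖u‖ ^ 2 := by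
      rw [norm_smul, mul_pow, Real.norm_eq_abs, sq_abs]
    rw [h6] at h1 h2 h5
    rw [h7] at h1 h3 h5
    linarith
  have hi : ∀ a b : H, -inner ℝ a b ≤ 1 / 2 * ‖a‖ ^ 2 + 1 / 2 * ‖b‖ ^ 2 := fun a b => by
    have h := inner_le_weighted (-a) b one_pos
    rw [inner_neg_left, norm_neg] at h
    linarith
  have hye := mul_le_mul_of_nonneg_left (hi y e) hη.le
  have hue := mul_le_mul_of_nonneg_left (hi u e) hη.le
  have hsq' := mul_le_mul_of_nonneg_left hsq (show 0 ≤ η ^ 2 / 2 by positivity)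
  have huL := mul_le_mul_of_nonneg_left (hi u (L y)) (show 0 ≤ η ^ 2 * β ^ 2 by positivity)
  have hLe : -(η ^ 2 * β * inner ℝ (L y) e)
      ≤ η ^ 2 * β ^ 2 / 2 * ‖L y‖ ^ 2 + η ^ 2 / 2 * ‖e‖ ^ 2 := by
    have h := mul_le_mul_of_nonneg_left (hi (β • L y) e) (sq_nonneg η)
    rw [real_inner_smul_left, norm_smul, Real.norm_of_nonneg hβ.le] at h
    linarith
  -- the dual perturbation against the dual variable, with weight `η / β`
  set s := η * (1 / β) with hs
  have hs0 : 0 < s := by positivity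
  have hs' : 1 / (2 * s) = β * (1 / η) / 2 := by rw [hs]; field_simp
  have hud1 := inner_apply_le_weighted hQsymm hQpos u d hs0
  have hud2 := mul_le_mul_of_nonneg_left (inner_le_weighted u d hs0) hM0
  -- the dual perturbation against the gradient of the consensus penalty
  have hLd1 : η * β * inner ℝ y d
      ≤ 1 / 2 * (η ^ 2 * β ^ 2 * inner ℝ y (L y)) + 1 / 2 * inner ℝ d (Q d) := by
    have h := inner_apply_le_weighted hQsymm hQpos ((η * β) • L y) d one_pos
    simp only [map_smul, real_inner_smul_left, real_inner_smul_right, hQd, hy,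
      real_inner_comm y (L y)] at h
    linarith
  have hLd2 : η * β * inner ℝ (L y) d ≤ 1 / 2 * (η ^ 2 * β ^ 2 * ‖L y‖ ^ 2) + 1 / 2 * ‖d‖ ^ 2 := by
    have h := inner_le_weighted ((η * β) • L y) d one_pos
    rw [real_inner_smul_left, norm_smul, Real.norm_of_nonneg (by positivity)] at h
    linarith
  have hLd3 := mul_le_mul_of_nonneg_left hLd2 hM0
  have hyd := inner_le_weighted y d hη
  have hη' : 1 / (2 * η) = 1 / η / 2 := by field_simp
  have hLd4 : -(η * (r * β * inner ℝ (L y) d))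
      ≤ 1 / 2 * (η ^ 2 * (r * β) ^ 2 * ‖L y‖ ^ 2) + 1 / 2 * ‖d‖ ^ 2 := by
    have h := hi ((η * (r * β)) • L y) d
    rw [real_inner_smul_left, norm_smul, Real.norm_of_nonneg (by positivity)] at h
    linarith
  have hud3 : -(η * (β * inner ℝ u d)) ≤ 1 / 2 * (η ^ 2 * ‖u‖ ^ 2) + β ^ 2 / 2 * ‖d‖ ^ 2 := by
    have h := hi (η • u) (β • d)
    rw [real_inner_smul_left, real_inner_smul_right, norm_smul, norm_smul,
      Real.norm_of_nonneg hη.le, Real.norm_of_nonneg hβ.le] at h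
    linarith
  have hed : -(η * inner ℝ e d) ≤ 1 / 2 * (η ^ 2 * ‖e‖ ^ 2) + 1 / 2 * ‖d‖ ^ 2 := by
    have h := hi (η • e) d
    rw [real_inner_smul_left, norm_smul, Real.norm_of_nonneg hη.le] at h
    linarith
  -- spectral bounds
  have hyL' := mul_le_mul_of_nonneg_left hyL
    (show 0 ≤ η * (r - 1) * β by have := sub_nonneg.2 hr; positivity)
  have hL1' := mul_le_mul_of_nonneg_left (hL1 y) (show 0 ≤ η ^ 2 * β ^ 2 by positivity)
  have hL2' := mul_le_mul_of_nonneg_left (hL2 y)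
    (show 0 ≤ η ^ 2 * (2 * (r * β) ^ 2 + β ^ 2) by positivity)
  have hQu' := mul_le_mul_of_nonneg_left (hQle u) (show 0 ≤ s / 2 by positivity)
  have hQd' := mul_le_mul_of_nonneg_left (hQle d)
    (show 0 ≤ β * (1 / η) / 2 + 1 by positivity)
  rw [hs'] at hud1 hud2
  rw [hη'] at hyd
  rw [hexp]
  rw [hs] at hud1 hud2 hQu'
  clear_value s
  clear hexp hs hs0 hs' hη' hsq hi hLd2 hL1 hL2 hQle hQpos hQsymm
  generalize 1 / η = ηi at *
  generalize 1 / β = βi at *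
  generalize 1 / ρ₂ = ρi at *
  linarith

lemma le_lyapQuad {Q : H →ₗ[ℝ] H} {r : ℝ} (hQpos : ∀ a, 0 ≤ inner ℝ a (Q a)) (hr : 0 < r)
    (y u : H) : (1 - 1 / r) / 2 * ‖y‖ ^ 2 ≤ lyapQuad Q r y u := by
  have h := inner_le_weighted (-y) u (s := 1 / r) (by positivity)
  rw [inner_neg_left, norm_neg] at h
  have h1 : 1 / (2 * (1 / r)) = r / 2 := by field_simp
  rw [h1] at h
  have := hQpos u
  unfold lyapQuad
  linarith

/-- With `c = 1 / ρ₂ + r`, the trace `(1 + c) / 2` of the matrix `½ [[1, 1], [1, c]]` exceeds its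
largest eigenvalue by at least `(c - 1) / (2 (c + 1))`. -/
lemma lyapQuad_le {Q : H →ₗ[ℝ] H} {ρ₂ r t : ℝ} (hQle : ∀ a, inner ℝ a (Q a) ≤ 1 / ρ₂ * ‖a‖ ^ 2)
    (hc : 1 ≤ 1 / ρ₂ + r) (ht : t * (2 * (1 / ρ₂ + r + 1)) ≤ 1 / ρ₂ + r - 1) (y u : H) :
    lyapQuad Q r y u ≤ ((1 + (1 / ρ₂ + r)) / 2 - t) * (‖y‖ ^ 2 + ‖u‖ ^ 2) := by
  have hQ := hQle u
  generalize 1 / ρ₂ = q at *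
  have hs : 0 < q + r - 2 * t := by
    by_contra hneg
    nlinarith
  have h := inner_le_weighted y u hs
  have h1 : 1 / (2 * (q + r - 2 * t)) ≤ 1 / 2 - t := by
    rw [div_le_iff₀ (by positivity)]
    nlinarith [sq_nonneg t]
  have h2 := mul_le_mul_of_nonneg_right h1 (sq_nonneg ‖u‖)
  unfold lyapQuad
  linarith

end LyapQuad

/-! ### The constants -/

section Constants

variable {ρ ρ₂ Lf ν κ₂ α β η : ℝ}

lemma eps8_eq (hβ : 0 < β) : eps8 ρ₂ α β = (1 + (1 / ρ₂ + α / β)) / 2 := by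
  unfold eps8
  field_simp
  ring

/-- The conditions on the step size say that the three net decrease coefficients are positive. -/
lemma params_pos (hρ₂ : 0 < ρ₂) (hρ : ρ₂ ≤ ρ) (hLf : 0 < Lf)
    (hα : α ∈ Set.Ioc (β + kappa1t ρ₂ Lf) (κ₂ * β))
    (hβ : β > max (kappa1t ρ₂ Lf / (κ₂ - 1)) (max (kappa3 ρ₂ κ₂) (kappa4t ρ₂ Lf κ₂)))
    (hη : η ∈ Set.Ioo 0 (min (eps1t ρ₂ Lf α β / eps2t ρ Lf α β)
        (min (eps3 ρ₂ α β / eps4 β) (eps5t ρ₂ Lf α β / eps6t ρ₂ Lf α β)))) :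
    0 < β ∧ β < α ∧ 0 < η ∧ 0 < eps1t ρ₂ Lf α β - η * eps2t ρ Lf α β ∧
      0 < eps3 ρ₂ α β - η * eps4 β ∧ 0 < eps5t ρ₂ Lf α β - η * eps6t ρ₂ Lf α β := by
  have hρ' : 0 < ρ := hρ₂.trans_le hρ
  have hβ0 : 0 < β := by
    have h1 : kappa3 ρ₂ κ₂ < β := ((le_max_left _ _).trans (le_max_right _ _)).trans_lt hβ
    have h2 : 0 ≤ kappa3 ρ₂ κ₂ := by unfold kappa3; positivity
    linarith
  have hκ : 0 < kappa1t ρ₂ Lf := by unfold kappa1t; positivity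
  have hαβ : β < α := by linarith [hα.1]
  have hα0 : 0 < α := hβ0.trans hαβ
  have h1 := hη.2
  rw [lt_min_iff, lt_min_iff] at h1
  obtain ⟨h1, h2, h3⟩ := h1
  rw [lt_div_iff₀ (by unfold eps2t; positivity)] at h1
  rw [lt_div_iff₀ (by unfold eps4; positivity)] at h2
  rw [lt_div_iff₀ (by unfold eps6t; positivity)] at h3
  exact ⟨hβ0, hαβ, hη.1, by linarith, by linarith, by linarith⟩

lemma eps10t_pos (hν : 0 < ν) (hη : 0 < η) (h1 : 0 < eps1t ρ₂ Lf α β - η * eps2t ρ Lf α β)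
    (h3 : 0 < eps3 ρ₂ α β - η * eps4 β) : 0 < eps10t ρ ρ₂ Lf ν α β η :=
  mul_pos hη (lt_min h1 (lt_min h3 (by positivity)))

/-- Maximizing `η (ε₁ - η ε₂)` over `η` gives `ε₁² / (4 ε₂)`, which is at most
`((α - β) / α)² / 8` because `ρ₂ ≤ ρ`. -/
lemma eps10t_le (hρ₂ : 0 < ρ₂) (hρ : ρ₂ ≤ ρ) (hβ : 0 < β) (hαβ : β < α) (hη : 0 < η) :
    eps10t ρ ρ₂ Lf ν α β η ≤ ((α - β) / α) ^ 2 / 8 := by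
  have hα : 0 < α := hβ.trans hαβ
  have hρ0 : 0 < ρ := hρ₂.trans_le hρ
  have he : eps10t ρ ρ₂ Lf ν α β η ≤ η * (eps1t ρ₂ Lf α β - η * eps2t ρ Lf α β) :=
    mul_le_mul_of_nonneg_left (min_le_left _ _) hη.le
  refine he.trans ?_
  set a := (α - β) * ρ with ha
  have e1 : eps1t ρ₂ Lf α β ≤ a := by
    have : (α - β) * ρ₂ ≤ (α - β) * ρ := mul_le_mul_of_nonneg_left hρ (by linarith)
    unfold eps1t
    nlinarith [sq_nonneg Lf]
  have e2 : 2 * α ^ 2 * ρ ^ 2 ≤ eps2t ρ Lf α β := by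
    have : 0 ≤ β ^ 2 * ρ + β ^ 2 * ρ ^ 2 + 15 / 2 * Lf ^ 2 := by positivity
    unfold eps2t
    linarith
  have h2 : η * (eps1t ρ₂ Lf α β - η * eps2t ρ Lf α β) ≤ η * (a - η * (2 * α ^ 2 * ρ ^ 2)) := by
    gcongr
  refine h2.trans ?_
  rw [div_pow, div_div, le_div_iff₀ (by positivity)]
  have h3 : (α - β) ^ 2 * ρ ^ 2 = a ^ 2 := by rw [ha]; ring
  refine le_of_mul_le_mul_right ?_ (pow_pos hρ0 2)
  rw [h3]
  nlinarith [sq_nonneg (a - 4 * α ^ 2 * ρ ^ 2 * η)]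

/-- The gap needed to bound the initial value of the Lyapunov function by `(1 - ε̃) ε₈ Û₀`. -/
lemma eps10t_mul_le (hρ₂ : 0 < ρ₂) (hβ : 0 < β) (hαβ : β < α)
    {t : ℝ} (ht : t ≤ ((α - β) / α) ^ 2 / 8) :
    t * (2 * (1 / ρ₂ + α / β + 1)) ≤ 1 / ρ₂ + α / β - 1 := by
  have hα : 0 < α := hβ.trans hαβ
  have hr : 1 < α / β := (one_lt_div hβ).2 hαβ
  have hq : 0 < 1 / ρ₂ := by positivity
  have h1 : (α - β) / α = (α / β - 1) / (α / β) := by field_simp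
  rw [h1] at ht
  set r := α / β
  set q := 1 / ρ₂
  have h2 : t * (8 * r ^ 2) ≤ (r - 1) ^ 2 := by
    have h3 : ((r - 1) / r) ^ 2 / 8 = (r - 1) ^ 2 / (8 * r ^ 2) := by field_simp
    rwa [h3, le_div_iff₀ (by positivity)] at ht
  have h4 : (r - 1) ^ 2 * (2 * (q + r + 1)) ≤ (q + r - 1) * (8 * r ^ 2) := by
    have h5 : (r - 1) ^ 2 ≤ r * (r - 1) := by nlinarith
    nlinarith [mul_pos hq (show 0 < r - 1 by linarith), mul_pos hq (show 0 < r by linarith),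
      mul_pos (show 0 < r - 1 by linarith) (show 0 < r by linarith),
      mul_pos (mul_pos hq (show 0 < r by linarith)) (show 0 < r by linarith)]
  refine le_of_mul_le_mul_right ?_ (show 0 < 8 * r ^ 2 by positivity)
  calc t * (2 * (q + r + 1)) * (8 * r ^ 2) = t * (8 * r ^ 2) * (2 * (q + r + 1)) := by ring
    _ ≤ (r - 1) ^ 2 * (2 * (q + r + 1)) := mul_le_mul_of_nonneg_right h2 (by positivity)
    _ ≤ _ := h4

/-- The weight of the function value in the Lyapunov function. The value `4 ε₉` is what makes the
constant `1 + 1 / (2 ν)` suffice in the bound on the distance to the minimizers. -/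
def costWeight (ρ α β : ℝ) : ℝ := max 1 (4 * eps9 ρ α β)

lemma eps9_le (hα : 0 < α) : eps9 ρ α β ≤ (1 - 1 / (α / β)) / 2 := by
  refine (min_le_right _ _).trans_eq ?_
  field_simp

lemma costWeight_le_two (hβ : 0 < β) (hαβ : β < α) : costWeight ρ α β ≤ 2 := by
  have h := eps9_le (ρ := ρ) (β := β) (hβ.trans hαβ)
  have : 0 < 1 / (α / β) := by have := hβ.trans hαβ; positivity
  exact max_le (by norm_num) (by linarith)

lemma costWeight_le (hρ₂ : 0 < ρ₂) (hβ : 0 < β) (hαβ : β < α)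
    {t : ℝ} (ht : t ≤ ((α - β) / α) ^ 2 / 8) : costWeight ρ α β ≤ eps8 ρ₂ α β - t := by
  have hα : 0 < α := hβ.trans hαβ
  have hr : 1 < α / β := (one_lt_div hβ).2 hαβ
  have hq : 0 < 1 / ρ₂ := by positivity
  have h1 : (α - β) / α = 1 - 1 / (α / β) := by field_simp
  have h9 := eps9_le (ρ := ρ) (β := β) hα
  rw [eps8_eq hβ]
  rw [h1] at ht
  set r := α / β
  set q := 1 / ρ₂
  set w := 1 / r with hw
  have hwr : w * r = 1 := by rw [hw]; field_simp
  have hw0 : 0 < w := by positivity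
  have hw1 : w < 1 := by nlinarith
  -- `r ≥ 2 - w` is the inequality between `r` and its reciprocal
  have hrw : 2 - w ≤ r := by nlinarith [sq_nonneg (r - 1)]
  refine max_le ?_ ?_
  · nlinarith
  · have : r = (r - 1) ^ 2 * w + 2 - w := by linear_combination (-(r - 2)) * hwr
    have h3 : 4 - 4 * w + (1 - w) ^ 2 / 4 ≤ 1 + r := by
      nlinarith [sq_nonneg (r * 2 - 3), mul_pos hw0 hw0, sq_nonneg (w * 4 - 3),
        mul_nonneg hw0.le (sq_nonneg (r - 2))]
    linarith

end Constants

/-! ### A linear recursion with geometric perturbation -/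

section Recursion

/-- Iterating the recursion: the geometric perturbations accumulate to a convolution sum. -/
lemma le_of_geometric_recursion {V : ℕ → ℝ} {a b e₁ e₂ : ℝ} (ha : 0 ≤ a)
    (hV : ∀ k, V (k + 1) ≤ a * V k + (e₁ * b ^ k + e₂ * b ^ (k + 1))) (k : ℕ) :
    V k ≤ a ^ k * V 0 + (e₁ + e₂ * b) * ∑ j ∈ Finset.range k, a ^ j * b ^ (k - 1 - j) := by
  induction k with
  | zero => simp
  | succ k ih =>
    have hS : ∑ j ∈ Finset.range (k + 1), a ^ j * b ^ (k + 1 - 1 - j)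
        = a * (∑ j ∈ Finset.range k, a ^ j * b ^ (k - 1 - j)) + b ^ k := by
      rw [Finset.sum_range_succ', Finset.mul_sum]
      simp only [pow_zero, one_mul, Nat.sub_zero, Nat.add_sub_cancel]
      congr 1
      refine Finset.sum_congr rfl fun j hj => ?_
      rw [pow_succ', mul_assoc, Nat.sub_sub, Nat.add_comm 1 j]
    rw [hS]
    have h1 := mul_le_mul_of_nonneg_left ih ha
    refine (hV k).trans ?_
    rw [pow_succ, pow_succ]
    linarith

lemma mul_geom_sum_le {a b c : ℝ} (ha : 0 < a) (hb : 0 < b) (hbc : b < c) (k : ℕ) {e₁ e₂ : ℝ}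
    (he₁ : 0 ≤ e₁) (he₂ : 0 ≤ e₂) :
    (e₁ + e₂ * b) * ∑ j ∈ Finset.range k, a ^ j * b ^ (k - 1 - j) ≤ phi e₁ e₂ (1 - a) b c k := by
  set S := ∑ j ∈ Finset.range k, a ^ j * b ^ (k - 1 - j) with hSdef
  have hS : S * (a - b) = a ^ k - b ^ k := (Commute.all a b).geom_sum₂_mul k
  have hS0 : 0 ≤ S := Finset.sum_nonneg fun j _ => by positivity
  have hak : 0 < a ^ k := by positivity
  have hbk : 0 < b ^ k := by positivity
  suffices h : ∀ T, a * S ≤ T → b * S ≤ T → (e₁ + e₂ * b) * S ≤ (e₁ / a + e₂) * T by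
    unfold phi
    rw [sub_sub_cancel]
    split_ifs with h1 h2
    · have hT : a * S ≤ a ^ (k + 1) / (a - b) := by
        rw [le_div_iff₀ (by linarith), mul_assoc, hS, pow_succ]; nlinarith
      exact h _ hT ((mul_le_mul_of_nonneg_right h1.lt.le hS0).trans hT)
    · have hT : b * S ≤ b ^ (k + 1) / (b + (1 - a) - 1) := by
        rw [le_div_iff₀ (by linarith), pow_succ]; nlinarith
      exact h _ ((mul_le_mul_of_nonneg_right h2.le hS0).trans hT) hT
    · have hab : a = b := le_antisymm (not_lt.1 h1) (not_lt.1 h2)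
      have hc : 0 < c := hb.trans hbc
      -- in the resonant case `S = k b ^ (k - 1)`, compared with the geometric sum of `c` and `b`
      have hSc : S * (c - b) ≤ c ^ k := by
        have h3 : S ≤ ∑ j ∈ Finset.range k, c ^ j * b ^ (k - 1 - j) :=
          Finset.sum_le_sum fun j _ => by rw [hab]; gcongr
        have h4 := (Commute.all c b).geom_sum₂_mul k
        have h5 := mul_le_mul_of_nonneg_right h3 (sub_nonneg.2 hbc.le)
        linarith
      have hT : b * S ≤ c ^ (k + 1) / (c - b) := by
        rw [le_div_iff₀ (by linarith), pow_succ, mul_assoc, mul_comm]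
        exact mul_le_mul hSc hbc.le hb.le (by positivity)
      exact h _ (by rwa [hab]) hT
  intro T h1 h2
  have h3 : e₁ * S ≤ e₁ / a * T := by
    rw [div_mul_eq_mul_div, le_div_iff₀ ha, mul_assoc]
    exact mul_le_mul_of_nonneg_left (by linarith) he₁
  have h4 := mul_le_mul_of_nonneg_left h2 he₂
  linarith

end Recursion

/-! ### Averages and disagreements of stacked vectors -/

section Average

variable {n p : ℕ}

lemma avg_add (z w : Fin n → Vec p) : avg (fun i => z i + w i) = avg z + avg w := by
  simp [avg, Finset.sum_add_distrib, smul_add]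

lemma avg_smul (c : ℝ) (z : Fin n → Vec p) : avg (fun i => c • z i) = c • avg z := by
  simp only [avg, ← Finset.smul_sum]
  exact smul_comm _ _ _

lemma avg_sub (z w : Fin n → Vec p) : avg (fun i => z i - w i) = avg z - avg w := by
  simp [avg, Finset.sum_sub_distrib, smul_sub]

lemma natCast_smul_avg (hn : 0 < n) (z : Fin n → Vec p) : (n : ℝ) • avg z = ∑ i, z i := by
  have : (n : ℝ) ≠ 0 := by positivity
  rw [avg, smul_smul, mul_one_div_cancel this, one_smul]

/-- The orthogonal projection of a stacked vector onto the stacks whose blocks sum to zero. -/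
def cen : Stack n p →ₗ[ℝ] Stack n p := matAct (Kmat n)

lemma cen_apply (z : Stack n p) (i : Fin n) : cen z i = z i - avg z.ofLp := by
  simp [cen, Kmat, Matrix.one_apply, sub_smul, Finset.sum_sub_distrib, avg, Finset.smul_sum]

lemma sum_cen (hn : 0 < n) (z : Stack n p) : ∑ i, cen z i = 0 := by
  simp only [cen_apply, Finset.sum_sub_distrib]
  rw [← natCast_smul_avg hn]
  simp [← Nat.cast_smul_eq_nsmul ℝ]

lemma cen_eq_self {z : Stack n p} (hz : ∑ i, z i = 0) : cen z = z := by
  ext1 i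
  rw [cen_apply, avg, hz, smul_zero, sub_zero]

/-- Pythagoras for the splitting into disagreement and average. -/
lemma norm_cen_sq_add (hn : 0 < n) (z : Stack n p) :
    ‖cen z‖ ^ 2 + n * ‖avg z.ofLp‖ ^ 2 = ‖z‖ ^ 2 := by
  have h1 : ∑ i, inner ℝ (cen z i) (avg z.ofLp) = 0 := by
    rw [← sum_inner, sum_cen hn, inner_zero_left]
  have h2 : ∀ i, ‖z i‖ ^ 2
      = ‖cen z i‖ ^ 2 + 2 * inner ℝ (cen z i) (avg z.ofLp) + ‖avg z.ofLp‖ ^ 2 := fun i => by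
    rw [← norm_add_sq_real, cen_apply, sub_add_cancel]
  rw [PiLp.norm_sq_eq_of_L2 _ z, PiLp.norm_sq_eq_of_L2 _ (cen z), Finset.sum_congr rfl fun i _ => h2 i,
    Finset.sum_add_distrib, Finset.sum_add_distrib, ← Finset.mul_sum, h1]
  simp

lemma norm_cen_sq_le (hn : 0 < n) (z : Stack n p) : ‖cen z‖ ^ 2 ≤ ‖z‖ ^ 2 := by
  rw [← norm_cen_sq_add hn z]
  have : 0 ≤ (n : ℝ) * ‖avg z.ofLp‖ ^ 2 := by positivity
  linarith

lemma mul_norm_avg_sq_le (hn : 0 < n) (z : Fin n → Vec p) :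
    n * ‖avg z‖ ^ 2 ≤ ∑ i, ‖z i‖ ^ 2 := by
  have h := norm_cen_sq_add hn (WithLp.toLp 2 z)
  rw [PiLp.norm_sq_eq_of_L2 _ (WithLp.toLp 2 z)] at h
  have h2 := sq_nonneg ‖cen (WithLp.toLp 2 z)‖
  simp only at h
  linarith

lemma stackSq_sub_avg (z : Fin n → Vec p) :
    stackSq (fun i => z i - avg z) = ‖cen (WithLp.toLp 2 z)‖ ^ 2 := by
  rw [PiLp.norm_sq_eq_of_L2]
  simp only [stackSq, cen_apply]

lemma stackSq_sub_const (hn : 0 < n) (z : Fin n → Vec p) (a : Vec p) :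
    stackSq (fun i => z i - a) = ‖cen (WithLp.toLp 2 z)‖ ^ 2 + n * ‖avg z - a‖ ^ 2 := by
  have h := norm_cen_sq_add hn (WithLp.toLp 2 fun i => z i - a)
  have h1 : avg (fun _ : Fin n => a) = a := by
    have : (n : ℝ) ≠ 0 := by positivity
    rw [avg, Finset.sum_const, Finset.card_univ, Fintype.card_fin, ← Nat.cast_smul_eq_nsmul ℝ,
      smul_smul, one_div_mul_cancel this, one_smul]
  have h2 : cen (WithLp.toLp 2 fun i => z i - a) = cen (WithLp.toLp 2 z) := by
    ext1 i
    simp only [cen_apply]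
    rw [avg_sub, h1]
    abel
  rw [h2, PiLp.norm_sq_eq_of_L2 _ (WithLp.toLp 2 fun i => z i - a)] at h
  simp only at h
  rw [avg_sub, h1] at h
  exact h.symm

lemma stackQuad_Kmat (hn : 0 < n) (z : Fin n → Vec p) :
    stackQuad (Kmat n) z = ‖cen (WithLp.toLp 2 z)‖ ^ 2 := by
  have h1 : stackQuad (Kmat n) z
      = inner ℝ (WithLp.toLp 2 z : Stack n p) (cen (WithLp.toLp 2 z)) := (inner_matAct _ _ _).symm
  have h2 : ∑ i, inner ℝ (avg z) (cen (WithLp.toLp 2 z) i) = 0 := by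
    rw [← inner_sum, sum_cen hn, inner_zero_right]
  have h3 : ∀ i, inner ℝ (z i) (cen (WithLp.toLp 2 z) i)
      = ‖cen (WithLp.toLp 2 z) i‖ ^ 2 + inner ℝ (avg z) (cen (WithLp.toLp 2 z) i) := fun i => by
    rw [← real_inner_self_eq_norm_sq, ← inner_add_left]
    congr 1
    rw [cen_apply, sub_add_cancel]
  rw [h1, PiLp.inner_apply, PiLp.norm_sq_eq_of_L2]
  simp only [h3, Finset.sum_add_distrib, h2, add_zero]

end Average

namespace WGraph

variable {n p : ℕ} (G : WGraph n)

lemma sum_matAct_lap (z : Stack n p) : ∑ i, matAct G.lap z i = 0 := by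
  simp only [matAct_apply]
  rw [Finset.sum_comm]
  refine Finset.sum_eq_zero fun j _ => ?_
  rw [← Finset.sum_smul, Finset.sum_congr rfl fun i _ => G.lap_symm i j, G.sum_lap_row, zero_smul]

lemma matAct_lap_cen (z : Stack n p) : matAct G.lap (cen z) = matAct G.lap z := by
  ext1 i
  simp [cen_apply, smul_sub, Finset.sum_sub_distrib, ← Finset.sum_smul, G.sum_lap_row]

lemma Connected.matAct_pinv_lap {G : WGraph n} (hG : G.Connected) {z : Stack n p}
    (hz : ∑ i, z i = 0) : matAct G.pinv (matAct G.lap z) = z := by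
  obtain ⟨c, hc⟩ := hG.one_sub_pinv_mul_lap
  have h : matAct (1 - G.pinv * G.lap) z = 0 := by
    ext1 i
    simp only [matAct_apply, hc, ← Finset.smul_sum, hz, smul_zero]
    rfl
  rw [matAct_sub, matAct_one, matAct_mul] at h
  exact (sub_eq_zero.1 h).symm

lemma inner_matAct_pinv_le (h0 : 0 < G.rho2) (z : Stack n p) :
    inner ℝ z (matAct G.pinv z) ≤ 1 / G.rho2 * ‖z‖ ^ 2 := by
  have h := inner_matAct_nonneg (G.posSemidef_inv_rho2_sub_pinv h0) z
  rw [matAct_sub, matAct_smul, matAct_one, inner_sub_right, real_inner_smul_right,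
    real_inner_self_eq_norm_sq] at h
  rw [one_div]
  linarith

lemma inner_matAct_lap_le (z : Stack n p) :
    inner ℝ z (matAct G.lap z) ≤ G.rho * ‖z‖ ^ 2 := by
  have h := inner_matAct_nonneg G.posSemidef_rho_sub_lap z
  rw [matAct_sub, matAct_smul, matAct_one, inner_sub_right, real_inner_smul_right,
    real_inner_self_eq_norm_sq] at h
  linarith

lemma norm_matAct_lap_sq_le (z : Stack n p) :
    ‖matAct G.lap z‖ ^ 2 ≤ G.rho ^ 2 * ‖z‖ ^ 2 := by
  have h := inner_matAct_nonneg G.posSemidef_rho_sq_sub_lap_mul_lap z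
  rw [matAct_sub, matAct_smul, matAct_one, matAct_mul, inner_sub_right, real_inner_smul_right,
    real_inner_self_eq_norm_sq, ← inner_matAct_comm G.lap_isHermitian,
    real_inner_self_eq_norm_sq] at h
  linarith

lemma Connected.le_inner_matAct_lap {G : WGraph n} (hG : G.Connected) {z : Stack n p}
    (hz : ∑ i, z i = 0) : G.rho2 * ‖z‖ ^ 2 ≤ inner ℝ z (matAct G.lap z) := by
  have h := inner_matAct_nonneg G.posSemidef_lap_sub_rho2 z
  rw [matAct_sub, matAct_smul, matAct_mul, hG.matAct_pinv_lap hz, inner_sub_right,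
    real_inner_smul_right, real_inner_self_eq_norm_sq] at h
  linarith

end WGraph

/-! ### Errors of the gradient estimators along a run -/

section Errors

variable {p : ℕ} {f : Vec p → ℝ} {Lf : ℝ}

lemma norm_add_add_sq_le {E : Type*} [SeminormedAddCommGroup E] (a b c : E) :
    ‖a + b + c‖ ^ 2 ≤ 3 * (‖a‖ ^ 2 + ‖b‖ ^ 2 + ‖c‖ ^ 2) := by
  have h : ‖a + b + c‖ ^ 2 ≤ (‖a‖ + ‖b‖ + ‖c‖) ^ 2 :=
    pow_le_pow_left₀ (norm_nonneg _) (norm_add₃_le) 2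
  nlinarith [sq_nonneg (‖a‖ - ‖b‖), sq_nonneg (‖a‖ - ‖c‖), sq_nonneg (‖b‖ - ‖c‖)]

lemma IsSmooth.norm_gradient_sub_sq_le (hf : IsSmooth f Lf) (x x' : Vec p) :
    ‖gradient f x - gradient f x'‖ ^ 2 ≤ Lf ^ 2 * ‖x - x'‖ ^ 2 := by
  rw [← mul_pow]
  exact pow_le_pow_left₀ (norm_nonneg _) (hf.2 x x') 2

lemma IsSmooth.norm_gradEst_sub_gradEst_sq_le (hf : IsSmooth f Lf) (x x' : Vec p) {δ δ' : ℝ}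
    (hδ : 0 < δ) (hδ' : 0 < δ') :
    ‖gradEst f x δ - gradEst f x' δ'‖ ^ 2
      ≤ 3 * (Lf ^ 2 * ‖x - x'‖ ^ 2 + p * Lf ^ 2 * δ ^ 2 / 4 + p * Lf ^ 2 * δ' ^ 2 / 4) := by
  have h1 := hf.norm_gradEst_sub_sq_le x hδ
  have h2 := hf.norm_gradEst_sub_sq_le x' hδ'
  have h3 := hf.norm_gradient_sub_sq_le x x'
  rw [← norm_sub_rev] at h2
  have h := norm_add_add_sq_le (gradient f x - gradient f x') (gradEst f x δ - gradient f x)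
    (gradient f x' - gradEst f x' δ')
  have he : gradient f x - gradient f x' + (gradEst f x δ - gradient f x)
      + (gradient f x' - gradEst f x' δ') = gradEst f x δ - gradEst f x' δ' := by abel
  rw [he] at h
  linarith

lemma IsSmooth.norm_gradEst_sub_gradient_sq_le (hf : IsSmooth f Lf) (x x' : Vec p) {δ : ℝ}
    (hδ : 0 < δ) :
    ‖gradEst f x δ - gradient f x'‖ ^ 2
      ≤ 5 / 4 * (Lf ^ 2 * ‖x - x'‖ ^ 2) + 5 * (p * Lf ^ 2 * δ ^ 2 / 4) := by
  have h1 := hf.norm_gradEst_sub_sq_le x hδ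
  have h3 := hf.norm_gradient_sub_sq_le x x'
  have h := norm_add_le (gradient f x - gradient f x') (gradEst f x δ - gradient f x)
  have he : gradient f x - gradient f x' + (gradEst f x δ - gradient f x)
      = gradEst f x δ - gradient f x' := by abel
  rw [he] at h
  have h2 := pow_le_pow_left₀ (norm_nonneg _) h 2
  nlinarith [sq_nonneg (‖gradient f x - gradient f x'‖ - 4 * ‖gradEst f x δ - gradient f x‖)]

end Errors

/-! ### The Lyapunov inequality -/

section Coefficients

variable {n p : ℕ} {ρ₂ Lf α β η : ℝ}

lemma dualCoeff_eps12 (hβ : 0 < β) (hη : 0 < η) :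
    ((1 / ρ₂ + α / β) * (β * (1 / η) / 2 + 1) + 1 / η / 2 + 1 + β ^ 2 / 2) * (1 / β ^ 2)
      * (3 * n * p * Lf ^ 2 / 4) = eps12 n p ρ₂ Lf α β η := by
  rw [eps12]
  congr 1
  generalize 1 / ρ₂ + α / β = q
  field_simp
  ring

lemma eps5t_eq : eps5t ρ₂ Lf α β
    = 1 / 8 - 3 / (2 * β) * (1 / β + (1 / ρ₂ + α / β)) * Lf ^ 2 := by
  unfold eps5t
  ring

lemma eps6t_eq : eps6t ρ₂ Lf α β
    = 3 / β ^ 2 * (1 + (1 / ρ₂ + α / β)) * Lf ^ 2 + 3 / 2 * Lf ^ 2 + Lf / 2 := by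
  unfold eps6t
  ring

lemma dualCoeff_eps5t (hβ : 0 < β) (hη : 0 < η) :
    ((1 / ρ₂ + α / β) * (β * (1 / η) / 2 + 1) + 1 / η / 2 + 1 + β ^ 2 / 2) * (1 / β ^ 2)
      * (3 * Lf ^ 2 * η ^ 2)
      = η * (1 / 8 - (eps5t ρ₂ Lf α β - η * eps6t ρ₂ Lf α β)) - η ^ 2 * Lf / 2 := by
  rw [eps5t_eq, eps6t_eq]
  generalize 1 / ρ₂ + α / β = q
  field_simp
  ring

lemma step_mul_le (hβ : 0 < β) (hη : 0 < η) (hLf : 0 < Lf) (hc : 0 ≤ 1 / ρ₂ + α / β)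
    (h5 : 0 < eps5t ρ₂ Lf α β - η * eps6t ρ₂ Lf α β) : η * Lf ≤ 1 / 4 := by
  rw [eps5t_eq, eps6t_eq] at h5
  have h1 : 0 ≤ 3 / (2 * β) * (1 / β + (1 / ρ₂ + α / β)) * Lf ^ 2 := by positivity
  have h2 : 0 ≤ η * (3 / β ^ 2 * (1 + (1 / ρ₂ + α / β)) * Lf ^ 2 + 3 / 2 * Lf ^ 2) := by positivity
  linarith

end Coefficients

/-- Combination of the estimates for one step. Here `W`, `F` are the quadratic part and the cost
part of the Lyapunov function, `Y`, `U` the squared norms of its two variables, `N` and `J` are `n`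
times the squared norms of the average estimator and of its error, `e` and `d` the squared norms of
the perturbations, and `D`, `D'` bound the squared exploration parameters. -/
lemma lyap_combine {n p : ℕ} {ρ ρ₂ Lf ν α β η m W W' F F' Y U N J e d D D' : ℝ}
    (hβ : 0 < β) (hη : 0 < η) (hLf : 0 < Lf)
    (hm1 : 1 ≤ m) (hm2 : m ≤ 2) (hY : 0 ≤ Y) (hU : 0 ≤ U) (hF : 0 ≤ F) (hN : 0 ≤ N) (hD : 0 ≤ D)
    (hc : 1 ≤ 1 / ρ₂ + α / β)
    (h10 : 0 ≤ eps10t ρ ρ₂ Lf ν α β η)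
    (h5 : 0 < eps5t ρ₂ Lf α β - η * eps6t ρ₂ Lf α β)
    (hWle : W ≤ eps8 ρ₂ α β * (Y + U))
    (hW : W' ≤ W
        - (η * ((α / β - 1) * β * ρ₂ - 1)
            - η ^ 2 * (β ^ 2 * ρ + (2 * (α / β * β) ^ 2 + β ^ 2) * ρ ^ 2)) * Y
        - (η * (β - 1 / 2 - (1 / ρ₂ + α / β) * (1 / β) / 2) - η ^ 2 * (2 * β ^ 2 + 1 / 2)) * U
        + (η + 5 / 2 * η ^ 2) * e
        + ((1 / ρ₂ + α / β) * (β * (1 / η) / 2 + 1) + 1 / η / 2 + 1 + β ^ 2 / 2) * d)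
    (hF' : F' ≤ F - η * ν * F - η / 2 * (1 - η * Lf) * N + η / 2 * J)
    (he : e ≤ 3 * Lf ^ 2 * Y + 2 * (3 * n * p * Lf ^ 2 / 4) * D)
    (hd : d ≤ 1 / β ^ 2 * (3 * Lf ^ 2 * (η ^ 2 * N) + 3 * n * p * Lf ^ 2 / 4 * (D + D')))
    (hJ : J ≤ 5 / 4 * (Lf ^ 2 * Y) + 5 / 3 * (3 * n * p * Lf ^ 2 / 4) * D) :
    W' + m * F' ≤ (1 - epst ρ ρ₂ Lf ν α β η) * (W + m * F)
      + (eps11 n p ρ₂ Lf α β η * D + eps12 n p ρ₂ Lf α β η * D') := by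
  set E := 3 * (n : ℝ) * p * Lf ^ 2 / 4 with hE
  have hE0 : 0 ≤ E := by positivity
  set q := 1 / ρ₂ + α / β with hq
  have h8 : eps8 ρ₂ α β = (1 + q) / 2 := eps8_eq hβ
  have h8' : 1 ≤ eps8 ρ₂ α β := by rw [h8]; linarith
  set κ := q * (β * (1 / η) / 2 + 1) + 1 / η / 2 + 1 + β ^ 2 / 2 with hκ
  have hκ0 : 0 ≤ κ := by positivity
  -- rewriting the coefficients through the named constants
  have c1 : η * ((α / β - 1) * β * ρ₂ - 1)
      - η ^ 2 * (β ^ 2 * ρ + (2 * (α / β * β) ^ 2 + β ^ 2) * ρ ^ 2)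
      = η * (eps1t ρ₂ Lf α β - η * eps2t ρ Lf α β)
        + η * (9 / 2 * Lf ^ 2) + η ^ 2 * (15 / 2 * Lf ^ 2) := by
    have h : α / β * β = α := div_mul_cancel₀ α hβ.ne'
    have h' : (α / β - 1) * β = α - β := by rw [sub_mul, h, one_mul]
    rw [h, h']
    unfold eps1t eps2t
    ring
  have c3 : η * (β - 1 / 2 - q * (1 / β) / 2) - η ^ 2 * (2 * β ^ 2 + 1 / 2)
      = η * (eps3 ρ₂ α β - η * eps4 β) := by
    have h : q * (1 / β) / 2 = α / (2 * β ^ 2) + 1 / (2 * β * ρ₂) := by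
      rw [hq]
      simp only [mul_inv, div_eq_mul_inv]
      ring
    rw [h]
    unfold eps3 eps4
    ring
  have c12 : κ * (1 / β ^ 2) * E = eps12 n p ρ₂ Lf α β η := by
    rw [← dualCoeff_eps12 hβ hη]
  have c5 : κ * (1 / β ^ 2) * (3 * Lf ^ 2 * η ^ 2)
      = η * (1 / 8 - (eps5t ρ₂ Lf α β - η * eps6t ρ₂ Lf α β)) - η ^ 2 * Lf / 2 :=
    dualCoeff_eps5t hβ hη
  have h5le : η * Lf ≤ 1 / 4 := step_mul_le hβ hη hLf (by linarith) h5
  rw [c1, c3] at hW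
  have t10 : eps10t ρ ρ₂ Lf ν α β η ≤ η * (eps1t ρ₂ Lf α β - η * eps2t ρ Lf α β) :=
    mul_le_mul_of_nonneg_left (min_le_left _ _) hη.le
  have t10' : eps10t ρ ρ₂ Lf ν α β η ≤ η * (eps3 ρ₂ α β - η * eps4 β) :=
    mul_le_mul_of_nonneg_left ((min_le_right _ _).trans (min_le_left _ _)) hη.le
  have t10'' : eps10t ρ ρ₂ Lf ν α β η ≤ η * (ν / 4) :=
    mul_le_mul_of_nonneg_left ((min_le_right _ _).trans (min_le_right _ _)) hη.le
  have hηLf : 0 ≤ η / 2 * (1 - η * Lf) := by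
    have : 0 ≤ 1 - η * Lf := by linarith
    positivity
  -- the loss in the squared average estimator absorbs its contribution to `d`
  have sN : κ * (1 / β ^ 2) * (3 * Lf ^ 2 * η ^ 2) * N ≤ m * (η / 2 * (1 - η * Lf) * N) := by
    have h1 : κ * (1 / β ^ 2) * (3 * Lf ^ 2 * η ^ 2) ≤ η / 2 * (1 - η * Lf) := by
      rw [c5]
      have := mul_pos hη h5
      linarith
    have h2 := mul_le_mul_of_nonneg_right h1 hN
    have h3 : 0 ≤ η / 2 * (1 - η * Lf) * N := mul_nonneg hηLf hN
    linarith [mul_le_mul_of_nonneg_right hm1 h3]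
  have se := mul_le_mul_of_nonneg_left he (show 0 ≤ η + 5 / 2 * η ^ 2 by positivity)
  have sd := mul_le_mul_of_nonneg_left hd hκ0
  have sF := mul_le_mul_of_nonneg_left hF' (show 0 ≤ m by linarith)
  have sJ : m * (η / 2 * J) ≤ η * (5 / 4 * (Lf ^ 2 * Y) + 5 / 3 * E * D) := by
    have h1 : 0 ≤ 5 / 4 * (Lf ^ 2 * Y) + 5 / 3 * E * D := by positivity
    calc m * (η / 2 * J) = m * η / 2 * J := by ring
      _ ≤ m * η / 2 * (5 / 4 * (Lf ^ 2 * Y) + 5 / 3 * E * D) :=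
        mul_le_mul_of_nonneg_left hJ (by positivity)
      _ ≤ _ := mul_le_mul_of_nonneg_right
        (by linarith [mul_le_mul_of_nonneg_right hm2 hη.le]) h1
  have sY := mul_le_mul_of_nonneg_right t10 hY
  have sU := mul_le_mul_of_nonneg_right t10' hU
  have sF2 : eps10t ρ ρ₂ Lf ν α β η * (m * F) ≤ m * (η * ν * F) := by
    have h1 : eps10t ρ ρ₂ Lf ν α β η ≤ η * ν := by linarith
    have h2 := mul_le_mul_of_nonneg_right h1 (show 0 ≤ m * F by positivity)
    linarith
  -- the decrease of the Lyapunov function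
  have sV : epst ρ ρ₂ Lf ν α β η * (W + m * F)
      ≤ eps10t ρ ρ₂ Lf ν α β η * (Y + U) + eps10t ρ ρ₂ Lf ν α β η * (m * F) := by
    have h80 : 0 < eps8 ρ₂ α β := by linarith
    have hmF : m * F ≤ eps8 ρ₂ α β * (m * F) :=
      le_mul_of_one_le_left (by positivity) h8'
    have ht : 0 ≤ epst ρ ρ₂ Lf ν α β η := div_nonneg h10 h80.le
    calc _ ≤ epst ρ ρ₂ Lf ν α β η * (eps8 ρ₂ α β * (Y + U) + eps8 ρ₂ α β * (m * F)) :=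
          mul_le_mul_of_nonneg_left (by linarith) ht
      _ = epst ρ ρ₂ Lf ν α β η * eps8 ρ₂ α β * (Y + U + m * F) := by ring
      _ = _ := by rw [epst, div_mul_cancel₀ _ h80.ne']; ring
  have c11 : eps11 n p ρ₂ Lf α β η = (15 * η / 4 + 5 * η ^ 2) * E + κ * (1 / β ^ 2) * E := by
    rw [eps11, c12]
  rw [c11, ← c12]
  have p1 : 0 ≤ η * (Lf ^ 2 * Y) := by positivity
  have p2 : 0 ≤ η * (E * D) := by positivity
  clear_value E q κ
  clear c1 c3 c5 c11 c12 hE hq hκ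
  generalize 1 / β ^ 2 = b at *
  linarith

/-! ### The Lyapunov function along a run -/

section Run

variable {n p : ℕ} {G : WGraph n} {f : Fin n → Vec p → ℝ} {Lf ν α β η : ℝ}
  {δ : Fin n → ℕ → ℝ} {x v : ℕ → Fin n → Vec p}

/-- The stacked estimators `h⁰_k` of the local gradients at the average. -/
def estAtAvg (f : Fin n → Vec p → ℝ) (δ : Fin n → ℕ → ℝ) (x : ℕ → Fin n → Vec p) (k : ℕ) :
    Stack n p :=
  WithLp.toLp 2 fun i => gradEst (f i) (avg (x k)) (deltaMax δ k)

/-- The disagreement of the agents. -/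
def disagreement (x : ℕ → Fin n → Vec p) (k : ℕ) : Stack n p := cen (WithLp.toLp 2 (x k))

/-- The centred dual variable, shifted by the value that would make the average stationary. -/
def dualDeviation (f : Fin n → Vec p → ℝ) (β : ℝ) (δ : Fin n → ℕ → ℝ)
    (x v : ℕ → Fin n → Vec p) (k : ℕ) : Stack n p :=
  cen (WithLp.toLp 2 (v k) + (1 / β) • estAtAvg f δ x k)

/-- The optimality gap `n (f(x̄_k) - f*)`. -/
def costGap (f : Fin n → Vec p → ℝ) (x : ℕ → Fin n → Vec p) (k : ℕ) : ℝ :=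
  n * (globalCost f (avg (x k)) - optVal (globalCost f))

/-- The Lyapunov function. -/
def lyap (G : WGraph n) (f : Fin n → Vec p → ℝ) (α β : ℝ) (δ : Fin n → ℕ → ℝ)
    (x v : ℕ → Fin n → Vec p) (k : ℕ) : ℝ :=
  lyapQuad (matAct G.pinv) (α / β) (disagreement x k) (dualDeviation f β δ x v k)
    + costWeight G.rho α β * costGap f x k

lemma Uhat_eq (hn : 0 < n) (k : ℕ) : Uhat f β δ x v k
    = ‖disagreement x k‖ ^ 2 + ‖dualDeviation f β δ x v k‖ ^ 2 + costGap f x k := by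
  unfold Uhat
  rw [stackQuad_Kmat hn, stackQuad_Kmat hn]
  rfl

lemma costGap_nonneg (hopt : (optSet (globalCost f)).Nonempty) (k : ℕ) : 0 ≤ costGap f x k :=
  mul_nonneg (Nat.cast_nonneg n) (sub_nonneg.2 (optVal_le hopt _))

lemma IsRun.sum_dual (hrun : IsRun G f α β η δ x v) (k : ℕ) : ∑ i, v k i = 0 := by
  induction k with
  | zero => simp [hrun.init]
  | succ k ih =>
    have h : ∑ i, ∑ j, G.lap i j • x k j = 0 := G.sum_matAct_lap (WithLp.toLp 2 (x k))
    simp only [hrun.v_step, Finset.sum_add_distrib, ih, ← Finset.smul_sum, h]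
    simp

/-- The average follows a gradient step with the averaged estimator: the consensus and the dual
terms cancel. -/
lemma IsRun.avg_succ (hrun : IsRun G f α β η δ x v) (k : ℕ) :
    avg (x (k + 1)) = avg (x k) - η • avg fun i => gradEst (f i) (x k i) (δ i k) := by
  have h1 : ∑ i, ∑ j, G.lap i j • x k j = 0 := G.sum_matAct_lap (WithLp.toLp 2 (x k))
  have h2 := hrun.sum_dual k
  have h3 : avg (fun i => ∑ j, G.lap i j • x k j) = 0 := by rw [avg, h1, smul_zero]
  have h4 : avg (v k) = 0 := by rw [avg, h2, smul_zero]
  rw [show x (k + 1) = fun i => x k i - η • (α • ∑ j, G.lap i j • x k j + β • v k i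
    + gradEst (f i) (x k i) (δ i k)) from funext (hrun.x_step k)]
  rw [avg_sub, avg_smul, avg_add, avg_add, avg_smul, avg_smul, h3, h4]
  simp

lemma IsRun.disagreement_succ (hrun : IsRun G f α β η δ x v) (hβ : 0 < β) (k : ℕ) :
    disagreement x (k + 1) = disagreement x k - η • ((α / β * β) • matAct G.lap (disagreement x k)
      + β • dualDeviation f β δ x v k
      + cen (WithLp.toLp 2 (fun i => gradEst (f i) (x k i) (δ i k)) - estAtAvg f δ x k)) := by
  have h : (WithLp.toLp 2 (x (k + 1)) : Stack n p) = WithLp.toLp 2 (x k)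
      - η • (α • matAct G.lap (WithLp.toLp 2 (x k)) + β • WithLp.toLp 2 (v k)
        + WithLp.toLp 2 fun i => gradEst (f i) (x k i) (δ i k)) := by
    ext1 i
    exact hrun.x_step k i
  have hL : cen (matAct G.lap (WithLp.toLp 2 (x k) : Stack n p))
      = matAct G.lap (disagreement x k) := by
    rw [cen_eq_self (G.sum_matAct_lap _), disagreement, G.matAct_lap_cen]
  rw [disagreement, h, map_sub, map_smul, map_add, map_add, map_smul, map_smul, hL,
    div_mul_cancel₀ _ hβ.ne', dualDeviation, map_add, map_smul, map_sub, smul_add β, smul_smul,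
    mul_one_div_cancel hβ.ne', one_smul, disagreement]
  congr 2
  abel

lemma IsRun.dualDeviation_succ (hrun : IsRun G f α β η δ x v) (k : ℕ) :
    dualDeviation f β δ x v (k + 1) = dualDeviation f β δ x v k
      + (η * β) • matAct G.lap (disagreement x k)
      + cen ((1 / β) • (estAtAvg f δ x (k + 1) - estAtAvg f δ x k)) := by
  have h : (WithLp.toLp 2 (v (k + 1)) : Stack n p) = WithLp.toLp 2 (v k)
      + (η * β) • matAct G.lap (WithLp.toLp 2 (x k)) := by
    ext1 i
    exact hrun.v_step k i
  have hL : cen (matAct G.lap (WithLp.toLp 2 (x k) : Stack n p))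
      = matAct G.lap (disagreement x k) := by
    rw [cen_eq_self (G.sum_matAct_lap _), disagreement, G.matAct_lap_cen]
  rw [dualDeviation, dualDeviation, h]
  simp only [map_add, map_smul, map_sub, hL, smul_sub]
  abel

/-- One step of the average, by the descent lemma and the Polyak–Łojasiewicz condition. -/
lemma IsRun.costGap_succ_le (hrun : IsRun G f α β η δ x v) (hn : 0 < n) (hη : 0 < η)
    (hsmooth : ∀ i, IsSmooth (f i) Lf) (hPL : SatisfiesPL (globalCost f) ν) (k : ℕ) :
    costGap f x (k + 1) ≤ costGap f x k - η * ν * costGap f x k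
      - η / 2 * (1 - η * Lf) * (n * ‖avg fun i => gradEst (f i) (x k i) (δ i k)‖ ^ 2)
      + η / 2 * (n * ‖(avg fun i => gradEst (f i) (x k i) (δ i k))
          - gradient (globalCost f) (avg (x k))‖ ^ 2) := by
  set h := avg fun i => gradEst (f i) (x k i) (δ i k)
  set g := gradient (globalCost f) (avg (x k)) with hg
  have h1 := (abs_le.1 ((isSmooth_globalCost hn hsmooth).abs_taylor_le (avg (x k)) (-(η • h)))).2
  rw [← sub_eq_add_neg, ← hrun.avg_succ k, ← hg, norm_neg, norm_smul, Real.norm_of_nonneg hη.le,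
    inner_neg_right, inner_smul_right] at h1
  have h2 := hPL (avg (x k))
  rw [← hg] at h2
  have h3 : ‖h - g‖ ^ 2 = ‖h‖ ^ 2 - 2 * inner ℝ g h + ‖g‖ ^ 2 := by
    rw [norm_sub_sq_real, real_inner_comm]
  have h4 := mul_le_mul_of_nonneg_left h2 hη.le
  have h5 : globalCost f (avg (x (k + 1))) - optVal (globalCost f)
      ≤ globalCost f (avg (x k)) - optVal (globalCost f)
        - η * ν * (globalCost f (avg (x k)) - optVal (globalCost f))
        - η / 2 * (1 - η * Lf) * ‖h‖ ^ 2 + η / 2 * ‖h - g‖ ^ 2 := by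
    rw [h3]
    linarith
  have h6 := mul_le_mul_of_nonneg_left h5 (Nat.cast_nonneg (α := ℝ) n)
  unfold costGap
  linarith

/-- The exploration parameters are controlled by a geometric sequence. -/
lemma exploration_bounds {εh : ℝ} (hn : 0 < n) (hεh : 0 < εh)
    (hδ : ∀ (i : Fin n) (k : ℕ), δ i k ∈ Set.Ioc 0 (εh ^ ((k : ℝ) / 2))) (k : ℕ) :
    (∀ i, δ i k ^ 2 ≤ εh ^ k) ∧ 0 < deltaMax δ k ∧ deltaMax δ k ^ 2 ≤ εh ^ k := by
  have : Nonempty (Fin n) := ⟨⟨0, hn⟩⟩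
  have hsq : (εh ^ ((k : ℝ) / 2)) ^ 2 = εh ^ k := by
    rw [← Real.rpow_natCast, ← Real.rpow_mul hεh.le]
    norm_num
  have h0 : 0 < deltaMax δ k :=
    (hδ ⟨0, hn⟩ k).1.trans_le (le_ciSup (f := fun i => δ i k) (Set.finite_range _).bddAbove ⟨0, hn⟩)
  refine ⟨fun i => ?_, h0, ?_⟩
  · rw [← hsq]
    exact pow_le_pow_left₀ (hδ i k).1.le (hδ i k).2 2
  · rw [← hsq]
    exact pow_le_pow_left₀ h0.le (ciSup_le fun i => (hδ i k).2) 2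

section Bounds

variable {D D' : ℝ} {k : ℕ}

lemma norm_estimator_error_sq_le (hn : 0 < n) (hsmooth : ∀ i, IsSmooth (f i) Lf)
    (hδ : ∀ i, 0 < δ i k) (hδD : ∀ i, δ i k ^ 2 ≤ D) (hm : 0 < deltaMax δ k)
    (hmD : deltaMax δ k ^ 2 ≤ D) :
    ‖cen (WithLp.toLp 2 (fun i => gradEst (f i) (x k i) (δ i k)) - estAtAvg f δ x k)‖ ^ 2
      ≤ 3 * Lf ^ 2 * ‖disagreement x k‖ ^ 2 + 2 * (3 * n * p * Lf ^ 2 / 4) * D := by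
  refine (norm_cen_sq_le hn _).trans ?_
  rw [PiLp.norm_sq_eq_of_L2, disagreement, ← stackSq_sub_avg, stackSq]
  have h : ∀ i, ‖gradEst (f i) (x k i) (δ i k) - gradEst (f i) (avg (x k)) (deltaMax δ k)‖ ^ 2
      ≤ 3 * Lf ^ 2 * ‖x k i - avg (x k)‖ ^ 2 + 3 / 2 * (p * Lf ^ 2) * D := fun i => by
    have h1 := (hsmooth i).norm_gradEst_sub_gradEst_sq_le (x k i) (avg (x k)) (hδ i) hm
    have hp : 0 ≤ (p : ℝ) * Lf ^ 2 := by positivity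
    have h2 := mul_le_mul_of_nonneg_left (hδD i) hp
    have h3 := mul_le_mul_of_nonneg_left hmD hp
    linarith
  calc _ ≤ ∑ i, (3 * Lf ^ 2 * ‖x k i - avg (x k)‖ ^ 2 + 3 / 2 * (p * Lf ^ 2) * D) :=
        Finset.sum_le_sum fun i _ => h i
    _ = _ := by
      rw [Finset.sum_add_distrib, ← Finset.mul_sum]
      simp
      ring

lemma norm_average_error_sq_le (hn : 0 < n) (hsmooth : ∀ i, IsSmooth (f i) Lf)
    (hδ : ∀ i, 0 < δ i k) (hδD : ∀ i, δ i k ^ 2 ≤ D) :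
    n * ‖(avg fun i => gradEst (f i) (x k i) (δ i k)) - gradient (globalCost f) (avg (x k))‖ ^ 2
      ≤ 5 / 4 * (Lf ^ 2 * ‖disagreement x k‖ ^ 2) + 5 / 3 * (3 * n * p * Lf ^ 2 / 4) * D := by
  rw [gradient_globalCost hsmooth, ← avg_sub, disagreement, ← stackSq_sub_avg, stackSq]
  refine (mul_norm_avg_sq_le hn _).trans ?_
  have h : ∀ i, ‖gradEst (f i) (x k i) (δ i k) - gradient (f i) (avg (x k))‖ ^ 2
      ≤ 5 / 4 * (Lf ^ 2 * ‖x k i - avg (x k)‖ ^ 2) + 5 / 4 * (p * Lf ^ 2) * D := fun i => by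
    have h1 := (hsmooth i).norm_gradEst_sub_gradient_sq_le (x k i) (avg (x k)) (hδ i)
    have hp : 0 ≤ (p : ℝ) * Lf ^ 2 := by positivity
    have h2 := mul_le_mul_of_nonneg_left (hδD i) hp
    linarith
  calc _ ≤ ∑ i, (5 / 4 * (Lf ^ 2 * ‖x k i - avg (x k)‖ ^ 2) + 5 / 4 * (p * Lf ^ 2) * D) :=
        Finset.sum_le_sum fun i _ => h i
    _ = _ := by
      rw [Finset.sum_add_distrib, ← Finset.mul_sum, ← Finset.mul_sum]
      simp
      ring

lemma IsRun.norm_estAtAvg_sub_sq_le (hrun : IsRun G f α β η δ x v) (hn : 0 < n) (hβ : 0 < β)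
    (hη : 0 < η) (hsmooth : ∀ i, IsSmooth (f i) Lf) (hm : ∀ k, 0 < deltaMax δ k)
    (hmD : deltaMax δ k ^ 2 ≤ D) (hmD' : deltaMax δ (k + 1) ^ 2 ≤ D') :
    ‖cen ((1 / β) • (estAtAvg f δ x (k + 1) - estAtAvg f δ x k))‖ ^ 2
      ≤ 1 / β ^ 2 * (3 * Lf ^ 2
          * (η ^ 2 * (n * ‖avg fun i => gradEst (f i) (x k i) (δ i k)‖ ^ 2))
        + 3 * n * p * Lf ^ 2 / 4 * (D + D')) := by
  refine (norm_cen_sq_le hn _).trans ?_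
  rw [norm_smul, mul_pow, Real.norm_of_nonneg (by positivity), one_div_pow,
    PiLp.norm_sq_eq_of_L2]
  refine mul_le_mul_of_nonneg_left ?_ (by positivity)
  set h := avg fun i => gradEst (f i) (x k i) (δ i k) with hh
  have hd : ‖avg (x (k + 1)) - avg (x k)‖ ^ 2 = η ^ 2 * ‖h‖ ^ 2 := by
    rw [hrun.avg_succ k, ← hh, sub_sub_cancel_left, norm_neg, norm_smul,
      Real.norm_of_nonneg hη.le, mul_pow]
  have hi : ∀ i, ‖gradEst (f i) (avg (x (k + 1))) (deltaMax δ (k + 1))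
      - gradEst (f i) (avg (x k)) (deltaMax δ k)‖ ^ 2
      ≤ 3 * Lf ^ 2 * (η ^ 2 * ‖h‖ ^ 2) + 3 * p * Lf ^ 2 / 4 * (D + D') := fun i => by
    have h1 := (hsmooth i).norm_gradEst_sub_gradEst_sq_le (avg (x (k + 1))) (avg (x k))
      (hm (k + 1)) (hm k)
    rw [hd] at h1
    have hp : 0 ≤ (p : ℝ) * Lf ^ 2 := by positivity
    have h2 := mul_le_mul_of_nonneg_left hmD hp
    have h3 := mul_le_mul_of_nonneg_left hmD' hp
    linarith
  calc _ ≤ ∑ _i : Fin n, (3 * Lf ^ 2 * (η ^ 2 * ‖h‖ ^ 2) + 3 * p * Lf ^ 2 / 4 * (D + D')) :=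
        Finset.sum_le_sum fun i _ => hi i
    _ = _ := by
      simp
      ring

end Bounds

end Run

/-! ### Linear convergence -/

section Convergence

variable {n p : ℕ} {G : WGraph n} {f : Fin n → Vec p → ℝ} {Lf ν α β η : ℝ}
  {δ : Fin n → ℕ → ℝ} {x v : ℕ → Fin n → Vec p}

/-- The Lyapunov function contracts by the factor `1 - ε̃` up to the exploration errors. -/
lemma IsRun.lyap_succ_le (hrun : IsRun G f α β η δ x v) (hn : 2 ≤ n) (hG : G.Connected)
    (hopt : (optSet (globalCost f)).Nonempty) (hLf : 0 < Lf) (hsmooth : ∀ i, IsSmooth (f i) Lf)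
    (hPL : SatisfiesPL (globalCost f) ν) (hβ : 0 < β) (hαβ : β < α) (hη : 0 < η)
    (h10 : 0 ≤ eps10t G.rho G.rho2 Lf ν α β η)
    (h5 : 0 < eps5t G.rho2 Lf α β - η * eps6t G.rho2 Lf α β)
    {D : ℕ → ℝ} (hδ : ∀ i k, 0 < δ i k) (hδD : ∀ i k, δ i k ^ 2 ≤ D k)
    (hm : ∀ k, 0 < deltaMax δ k) (hmD : ∀ k, deltaMax δ k ^ 2 ≤ D k) (k : ℕ) :
    lyap G f α β δ x v (k + 1) ≤ (1 - epst G.rho G.rho2 Lf ν α β η) * lyap G f α β δ x v k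
      + (eps11 n p G.rho2 Lf α β η * D k + eps12 n p G.rho2 Lf α β η * D (k + 1)) := by
  have hn0 : 0 < n := by omega
  have hρ₂ := (hG.rho2_mem hn).2
  have hr : 1 < α / β := (one_lt_div hβ).2 hαβ
  have hq : 0 < 1 / G.rho2 := by positivity
  have hsum : ∑ i, disagreement x k i = 0 := sum_cen hn0 _
  have hW := lyapQuad_step_le (L := matAct G.lap) (Q := matAct G.pinv) (ρ := G.rho)
    (ρ₂ := G.rho2) (inner_matAct_comm G.posSemidef_pinv.1)
    (inner_matAct_nonneg G.posSemidef_pinv) (G.inner_matAct_pinv_le hρ₂) G.inner_matAct_lap_le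
    G.norm_matAct_lap_sq_le hr.le hβ hη (hG.matAct_pinv_lap hsum) (hG.le_inner_matAct_lap hsum)
    (dualDeviation f β δ x v k)
    (cen (WithLp.toLp 2 (fun i => gradEst (f i) (x k i) (δ i k)) - estAtAvg f δ x k))
    (cen ((1 / β) • (estAtAvg f δ x (k + 1) - estAtAvg f δ x k)))
  rw [← hrun.disagreement_succ hβ, ← hrun.dualDeviation_succ] at hW
  have hWle := lyapQuad_le (Q := matAct G.pinv) (t := 0) (G.inner_matAct_pinv_le hρ₂)
    (show 1 ≤ 1 / G.rho2 + α / β by linarith) (by linarith) (disagreement x k)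
    (dualDeviation f β δ x v k)
  rw [sub_zero, ← eps8_eq hβ] at hWle
  exact lyap_combine hβ hη hLf (le_max_left _ _) (costWeight_le_two hβ hαβ) (sq_nonneg _)
    (sq_nonneg _) (costGap_nonneg hopt k) (by positivity) ((sq_nonneg _).trans (hmD k))
    (by linarith) h10 h5 hWle hW (hrun.costGap_succ_le hn0 hη hsmooth hPL k)
    (norm_estimator_error_sq_le hn0 hsmooth (fun i => hδ i k) (fun i => hδD i k) (hm k) (hmD k))
    (hrun.norm_estAtAvg_sub_sq_le hn0 hβ hη hsmooth hm (hmD k) (hmD (k + 1)))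
    (norm_average_error_sq_le hn0 hsmooth (fun i => hδ i k) (fun i => hδD i k))

lemma eps8_gt_one {ρ₂ : ℝ} (hρ₂ : 0 < ρ₂) (hβ : 0 < β) (hαβ : β < α) : 1 < eps8 ρ₂ α β := by
  have hr : 1 < α / β := (one_lt_div hβ).2 hαβ
  have hq : 0 < 1 / ρ₂ := by positivity
  rw [eps8_eq hβ]
  linarith

lemma epst_mem_Ioo {ρ ρ₂ : ℝ} (hρ₂ : 0 < ρ₂) (hβ : 0 < β) (hαβ : β < α)
    (h10 : 0 < eps10t ρ ρ₂ Lf ν α β η) (h10' : eps10t ρ ρ₂ Lf ν α β η ≤ ((α - β) / α) ^ 2 / 8) :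
    epst ρ ρ₂ Lf ν α β η ∈ Set.Ioo (0 : ℝ) 1 := by
  have h8 := eps8_gt_one hρ₂ hβ hαβ
  have hα : 0 < α := hβ.trans hαβ
  refine ⟨div_pos h10 (by linarith), (div_lt_one (by linarith)).2 ?_⟩
  have h1 : (α - β) / α ≤ 1 := (div_le_one hα).2 (by linarith)
  have h2 : 0 ≤ (α - β) / α := div_nonneg (by linarith) hα.le
  nlinarith

/-- The initial value of the Lyapunov function. The slack between `ε₈` and the true comparison
constant pays for one additional factor `1 - ε̃`. -/
lemma lyap_zero_le (hn : 0 < n) (hopt : (optSet (globalCost f)).Nonempty) (hρ₂ : 0 < G.rho2)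
    (hβ : 0 < β) (hαβ : β < α)
    (h10 : eps10t G.rho G.rho2 Lf ν α β η ≤ ((α - β) / α) ^ 2 / 8) :
    lyap G f α β δ x v 0
      ≤ (1 - epst G.rho G.rho2 Lf ν α β η) * eps8 G.rho2 α β * Uhat f β δ x v 0 := by
  have hr : 1 < α / β := (one_lt_div hβ).2 hαβ
  have hq : 0 < 1 / G.rho2 := by positivity
  have h8 := eps8_gt_one hρ₂ hβ hαβ
  have h1 := lyapQuad_le (Q := matAct G.pinv) (G.inner_matAct_pinv_le hρ₂)
    (show 1 ≤ 1 / G.rho2 + α / β by linarith) (eps10t_mul_le hρ₂ hβ hαβ h10) (disagreement x 0)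
    (dualDeviation f β δ x v 0)
  rw [← eps8_eq hβ] at h1
  have h2 := mul_le_mul_of_nonneg_right (costWeight_le (ρ := G.rho) hρ₂ hβ hαβ h10)
    (costGap_nonneg (x := x) hopt 0)
  have h3 : (1 - epst G.rho G.rho2 Lf ν α β η) * eps8 G.rho2 α β
      = eps8 G.rho2 α β - eps10t G.rho G.rho2 Lf ν α β η := by
    rw [sub_mul, one_mul, epst, div_mul_cancel₀ _ (by linarith)]
  rw [h3, Uhat_eq hn, lyap, mul_add]
  exact add_le_add h1 h2

end Convergence

end ZeroOrderPD

end

theorem theorem4 {n p : ℕ} (hn : 2 ≤ n)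
    -- the communication graph
    (G : WGraph n) (hG : G.Connected)
    (ρ ρ₂ : ℝ) (hρ : ρ = G.rho) (hρ₂ : ρ₂ = G.rho2)
    -- the cost functions
    (f : Fin n → Vec p → ℝ)
    (hopt : (optSet (globalCost f)).Nonempty)
    (Lf : ℝ) (hLf : 0 < Lf) (hsmooth : ∀ i, IsSmooth (f i) Lf)
    (ν : ℝ) (hν : 0 < ν) (hPL : SatisfiesPL (globalCost f) ν)
    -- the algorithm parameters
    (κ₂ α β η : ℝ) (hκ₂ : 1 < κ₂)
    (hα : α ∈ Set.Ioc (β + kappa1t ρ₂ Lf) (κ₂ * β))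
    (hβ : β > max (kappa1t ρ₂ Lf / (κ₂ - 1))
      (max (kappa3 ρ₂ κ₂) (kappa4t ρ₂ Lf κ₂)))
    (hη : η ∈ Set.Ioo 0
      (min (eps1t ρ₂ Lf α β / eps2t ρ Lf α β)
        (min (eps3 ρ₂ α β / eps4 β)
          (eps5t ρ₂ Lf α β / eps6t ρ₂ Lf α β))))
    (εh εb : ℝ) (hεh : εh ∈ Set.Ioo (0 : ℝ) 1) (hεb : εb ∈ Set.Ioo εh 1)
    (δ : Fin n → ℕ → ℝ) (hδ : ∀ (i : Fin n) (k : ℕ), δ i k ∈ Set.Ioc 0 (εh ^ ((k : ℝ) / 2)))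
    -- the generated sequence
    (x v : ℕ → Fin n → Vec p) (hrun : IsRun G f α β η δ x v)
    -- abbreviations for the constants of the bound
    (ε₈ ε₉ ε₁₁ ε₁₂ εt : ℝ)
    (hε₈ : ε₈ = eps8 ρ₂ α β) (hε₉ : ε₉ = eps9 ρ α β)
    (hε₁₁ : ε₁₁ = eps11 n p ρ₂ Lf α β η)
    (hε₁₂ : ε₁₂ = eps12 n p ρ₂ Lf α β η)
    (hεt : εt = epst ρ ρ₂ Lf ν α β η) :
    εt ∈ Set.Ioo (0 : ℝ) 1 ∧
    (∀ k : ℕ,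
      stackSq (fun i => x k i - avg (x k))
          + n * (globalCost f (avg (x k))
              - optVal (globalCost f))
        ≤ 1 / ε₉ * ((1 - εt) ^ (k + 1) * ε₈ * Uhat f β δ x v 0
            + phi ε₁₁ ε₁₂ εt εh εb k)) ∧
    (∀ P : Vec p → Vec p,
      IsProjection (optSet (globalCost f)) P →
      ∀ k : ℕ,
        stackSq (fun i => x k i - P (avg (x k)))
          ≤ 1 / ε₉ * (1 + 1 / (2 * ν))
              * ((1 - εt) ^ (k + 1) * ε₈ * Uhat f β δ x v 0
                + phi ε₁₁ ε₁₂ εt εh εb k)) := by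
  subst hρ hρ₂ hε₈ hε₉ hε₁₁ hε₁₂ hεt
  have hn0 : 0 < n := by omega
  obtain ⟨hmem, hρ₂⟩ := hG.rho2_mem hn
  have hρ : G.rho2 ≤ G.rho := G.le_rho hmem
  have hρ0 : 0 < G.rho := hρ₂.trans_le hρ
  obtain ⟨hβ0, hαβ, hη0, h1, h3, h5⟩ := params_pos hρ₂ hρ hLf hα hβ hη
  have hα0 : 0 < α := hβ0.trans hαβ
  have h10 : 0 < eps10t G.rho G.rho2 Lf ν α β η := eps10t_pos hν hη0 h1 h3
  have h10' : eps10t G.rho G.rho2 Lf ν α β η ≤ ((α - β) / α) ^ 2 / 8 :=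
    eps10t_le hρ₂ hρ hβ0 hαβ hη0
  have hεt := epst_mem_Ioo hρ₂ hβ0 hαβ h10 h10'
  have h9 : 0 < eps9 G.rho α β :=
    lt_min (by positivity) (div_pos (by linarith) (by linarith))
  have h12 : 0 ≤ eps12 n p G.rho2 Lf α β η := by unfold eps12; positivity
  have h11 : 0 ≤ eps11 n p G.rho2 Lf α β η := by unfold eps11; positivity
  have hexp := exploration_bounds hn0 hεh.1 hδ
  have hstep := hrun.lyap_succ_le hn hG hopt hLf hsmooth hPL hβ0 hαβ hη0 h10.le h5
    (fun i k => (hδ i k).1) (fun i k => (hexp k).1 i) (fun k => (hexp k).2.1)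
    (fun k => (hexp k).2.2)
  have ha : 0 < 1 - epst G.rho G.rho2 Lf ν α β η := by linarith [hεt.2]
  have hbound : ∀ k, lyap G f α β δ x v k
      ≤ (1 - epst G.rho G.rho2 Lf ν α β η) ^ (k + 1) * eps8 G.rho2 α β * Uhat f β δ x v 0
        + phi (eps11 n p G.rho2 Lf α β η) (eps12 n p G.rho2 Lf α β η)
            (epst G.rho G.rho2 Lf ν α β η) εh εb k := fun k => by
    have hk := le_of_geometric_recursion ha.le hstep k
    have hphi := mul_geom_sum_le ha hεh.1 hεb.1 k h11 h12
    rw [sub_sub_cancel] at hphi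
    have h0 := mul_le_mul_of_nonneg_left
      (lyap_zero_le (δ := δ) (x := x) (v := v) hn0 hopt hρ₂ hβ0 hαβ h10') (pow_pos ha k).le
    rw [pow_succ]
    linarith
  -- the Lyapunov function dominates the disagreement and the optimality gap
  have hquad : ∀ k, eps9 G.rho α β * ‖disagreement x k‖ ^ 2
      ≤ lyapQuad (matAct G.pinv) (α / β) (disagreement x k) (dualDeviation f β δ x v k) := fun k =>
    (mul_le_mul_of_nonneg_right (eps9_le hα0) (sq_nonneg _)).trans
      (le_lyapQuad (inner_matAct_nonneg G.posSemidef_pinv) (by positivity) _ _)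
  refine ⟨hεt, fun k => ?_, fun P hP k => ?_⟩
  · rw [one_div, inv_mul_eq_div, le_div_iff₀ h9, stackSq_sub_avg]
    refine le_trans ?_ (hbound k)
    have hF := costGap_nonneg (x := x) hopt k
    have hw : eps9 G.rho α β ≤ costWeight G.rho α β := by
      have : 4 * eps9 G.rho α β ≤ costWeight G.rho α β := le_max_right _ _
      linarith
    have hwF := mul_le_mul_of_nonneg_right hw hF
    have hq := hquad k
    change (‖disagreement x k‖ ^ 2 + costGap f x k) * eps9 G.rho α β ≤ _
    unfold lyap
    linarith
  · rw [mul_assoc, one_div, inv_mul_eq_div, le_div_iff₀ h9, stackSq_sub_const hn0]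
    refine le_trans ?_ (mul_le_mul_of_nonneg_left (hbound k) (by positivity))
    have hF := costGap_nonneg (x := x) hopt k
    have hdist : (n : ℝ) * ‖avg (x k) - P (avg (x k))‖ ^ 2 ≤ 2 / ν * costGap f x k := by
      have h := hPL.norm_sub_projection_sq_le (isSmooth_globalCost hn0 hsmooth) hopt hν hP
        (avg (x k))
      have h' := mul_le_mul_of_nonneg_left h (Nat.cast_nonneg (α := ℝ) n)
      rw [div_mul_eq_mul_div, le_div_iff₀ hν, costGap]
      linarith
    have hw : 4 * eps9 G.rho α β ≤ costWeight G.rho α β := le_max_right _ _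
    have hwF := mul_le_mul_of_nonneg_right hw
      (show 0 ≤ 1 / (2 * ν) * costGap f x k by positivity)
    have hdist' := mul_le_mul_of_nonneg_right hdist h9.le
    have he : 2 / ν * costGap f x k * eps9 G.rho α β
        = 4 * eps9 G.rho α β * (1 / (2 * ν) * costGap f x k) := by
      field_simp
      ring
    have hq := hquad k
    have hq0 : 0 ≤ 1 / (2 * ν)
        * lyapQuad (matAct G.pinv) (α / β) (disagreement x k) (dualDeviation f β δ x v k) :=
      mul_nonneg (by positivity) ((mul_nonneg h9.le (sq_nonneg _)).trans hq)
    have hm0 : 0 ≤ costWeight G.rho α β * costGap f x k :=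
      mul_nonneg (zero_le_one.trans (le_max_left _ _)) hF
    change (‖disagreement x k‖ ^ 2 + _) * eps9 G.rho α β ≤ _
    unfold lyap
    linarith
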